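/- **Model.** A streaming phase on graphs with vertex set $\{1,\dots,n\}$ is a randomized machine whose entire memory is a bit string. In a pass it reads every edge of the input graph $G$ exactly once, in an order chosen by an adversary (who may choose a new order before each pass, knowing the current state). After each edge, before the first pass and at the end of each pass, the memory is replaced by a random new one that depends only on the old memory and, where an edge is read, on that edge; before each pass the memory decides whether the phase is over. The memory used by a phase is the largest number of bits held between these updates. A two-phase algorithm runs a preprocessing phase from empty memory and then a sampling phase from the memory left by the first phase; its output is a function of the final memory. A word has $\lfloor\log_2 n\rfloor+1$ bits. **Graphlets.** Let $g_1,\dots,g_{m_k}$ represent the isomorphism classes of connected graphs on $k$ vertices. Let $l_i$ be the number of induced subgraphs of $G$ isomorphic to $g_i$, and $L=\sum_i l_i$. If $L>0$, the $k$-graphlet distribution of $G$ is $\mu=(l_1/L,\dots,l_{m_k}/L)$. **Theorem.** There are an absolute constant $C\in\mathbb N$ and a two-phase streaming algorithm with parameters $n\ge 1$, $k\ge 3$, $c>0$, $\alpha,\delta\in(0,1)$ and a number $M\in\mathbb N$ of words with $M\ge C(n+k\,m_k)$, such that for every simple graph $G$ on $n$ vertices and every adversary the algorithm always terminates, returns a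 probability distribution $\hat p$ on $\{1,\dots,m_k\}$, and satisfies the following. 1. With probability at least $1-\frac1n$, the preprocessing phase uses at most $C(1+\frac1c)$ passes and at most $C\,n^{1+c}(\ln(n+2))^{C}$ bits of memory. 2. The sampling phase always uses at most $$C\Big(k+\frac{k^{Ck}}{\alpha^4M}\ln\frac2\delta\Big)$$ passes and at most $M$ words of memory. 3. If $G$ has at least one $k$-graphlet, then with probability at least $1-\delta$, $\max_i|\hat p_i-\mu_i|\le\alpha$. -/

import Mathlib

noncomputable section

namespace GraphletStream

/-! ### The `k`-graphlet distribution -/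

/-- Isomorphism of connected graphs on `k` labelled vertices. -/
instance graphletSetoid (k : ℕ) : Setoid {H : SimpleGraph (Fin k) // H.Connected} where
  r H H' := Nonempty (H.1 ≃g H'.1)
  iseqv :=
    { refl := fun _ => ⟨SimpleGraph.Iso.refl⟩
      symm := fun ⟨f⟩ => ⟨f.symm⟩
      trans := fun ⟨f⟩ ⟨g⟩ => ⟨f.trans g⟩ }

/-- The isomorphism classes of connected graphs on `k` vertices. -/
def GraphletClass (k : ℕ) : Type := Quotient (graphletSetoid k)

instance (k : ℕ) : Finite (GraphletClass k) :=
  inferInstanceAs (Finite (Quotient (graphletSetoid k)))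

instance (k : ℕ) : Fintype (GraphletClass k) := Fintype.ofFinite _

/-- The chosen representative of an isomorphism class. -/
def GraphletClass.rep {k : ℕ} (i : GraphletClass k) : SimpleGraph (Fin k) := (Quotient.out i).1

/-- The number of vertex sets of `G` that induce a subgraph isomorphic to the representative of
the class `i`. Such a set has exactly `k` elements and induces a connected subgraph. -/
def graphletCount {n k : ℕ} (G : SimpleGraph (Fin n)) (i : GraphletClass k) : ℕ :=
  {S : Finset (Fin n) | Nonempty (G.induce (S : Set (Fin n)) ≃g i.rep)}.ncard

/-- The total number of `k`-graphlets of `G`. -/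
def numGraphlets {n : ℕ} (k : ℕ) (G : SimpleGraph (Fin n)) : ℕ :=
  ∑ i : GraphletClass k, graphletCount G i

/-- The `k`-graphlet distribution of `G` (meaningful when `G` has at least one `k`-graphlet). -/
def graphletDist {n k : ℕ} (G : SimpleGraph (Fin n)) (i : GraphletClass k) : ℝ :=
  (graphletCount G i : ℝ) / (numGraphlets k G : ℝ)

/-! ### Multi-pass streaming algorithms on edge streams -/

/-- The list `l` presents every edge of `G` exactly once, in some order. -/
def IsEdgeStream {n : ℕ} (G : SimpleGraph (Fin n)) (l : List (Sym2 (Fin n))) : Prop :=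
  l.Nodup ∧ ∀ e, e ∈ l ↔ e ∈ G.edgeSet

/-- The whole memory of an algorithm, a string of bits. -/
abbrev Memory := List Bool

/-- One phase of a randomized multi-pass streaming algorithm on graphs with vertex set `Fin n`.
All that the algorithm remembers, including any clock or counter, is the content of its memory;
every transition uses fresh randomness. -/
structure Phase (n : ℕ) where
  /-- what is done before the first pass of the phase -/
  start : Memory → PMF Memory
  /-- decides, before every pass, whether the phase is over -/
  halt : Memory → Bool
  /-- the update of the memory when the next edge of the stream is read -/
  step : Memory → Sym2 (Fin n) → PMF Memory
  /-- what is done at the end of a pass -/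
  endPass : Memory → PMF Memory

/-- A phase in progress: the present memory, the number of completed passes of the phase, and the
largest number of bits held in memory so far during the phase. -/
structure Config where
  mem : Memory
  passes : ℕ
  peak : ℕ

/-- Replace the memory, keeping track of the peak. -/
def Config.store (s : Config) (m : Memory) : Config :=
  { s with mem := m, peak := max s.peak m.length }

namespace Phase

variable {n : ℕ}

/-- Read the edges of a list one after the other. -/
def scan (A : Phase n) : List (Sym2 (Fin n)) → Config → PMF Config
  | [], s => PMF.pure s
  | e :: es, s => ((A.step s.mem e).map s.store).bind (A.scan es)

/-- One pass over the edge list `l`. -/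
def pass (A : Phase n) (l : List (Sym2 (Fin n))) (s : Config) : PMF Config :=
  (A.scan l s).bind fun t =>
    (A.endPass t.mem).map fun m => { t.store m with passes := t.passes + 1 }

/-- Make passes until the phase halts, but at most `N` of them. The adversary chooses the order of
the edges before each pass, knowing the configuration. -/
def runFrom (A : Phase n) (order : Config → List (Sym2 (Fin n))) : ℕ → Config → PMF Config
  | 0, s => PMF.pure s
  | N + 1, s => if A.halt s.mem then PMF.pure s
      else (A.pass (order s) s).bind (A.runFrom order N)

/-- Run the phase from the memory content `m`, for at most `N` passes. -/
def run (A : Phase n) (order : Config → List (Sym2 (Fin n))) (N : ℕ) (m : Memory) : PMF Config :=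
  (A.start m).bind fun m' => A.runFrom order N ⟨m', 0, max m.length m'.length⟩

end Phase

/-- A two-phase streaming algorithm that estimates the `k`-graphlet distribution: its output is
read off the memory at the end of the second phase. -/
structure TwoPhaseAlg (n k : ℕ) where
  preprocessing : Phase n
  sampling : Phase n
  output : Memory → GraphletClass k → ℝ

/-- The joint law of the configurations at the end of the two phases. The memory is empty at
first, and the second phase starts with the memory that the first phase leaves. Each phase is cut
off after `N` passes, so this is the law of the complete execution if both phases have halted
by then. -/
def TwoPhaseAlg.run {n k : ℕ} (A : TwoPhaseAlg n k) (order₁ : Config → List (Sym2 (Fin n)))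
    (order₂ : Config → Config → List (Sym2 (Fin n))) (N : ℕ) : PMF (Config × Config) :=
  (A.preprocessing.run order₁ N []).bind fun s₁ =>
    (A.sampling.run (order₂ s₁) N s₁.mem).map fun s₂ => (s₁, s₂)

/-- The number of bits of a machine word: the binary length of `n`. -/
def wordSize (n : ℕ) : ℕ := Nat.log 2 n + 1

end GraphletStream

end

/-! Call a vertex alive if its component has at least `k` vertices, that is, if it belongs to some
`k`-graphlet. One pass over the edges suffices to find the degrees and the components, in
`O(n log n)` bits, and the degrees `d` of the alive vertices are all that the second phase needs.

A trial starts at a random alive vertex, chosen with probability proportional to `d ^ (k - 1)`, and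
then makes `k - 1` growth passes. If the present set `S` has `i` vertices and the maximum of `d` on
`S` is `D`, then at most `i * D` edges leave `S` for vertices with `d ≤ D`. Reservoir sampling
selects each of them with probability `1 / (i * D)`, and the trial fails if none is selected. Since
`D` never changes, the factors `1 / D` cancel against the weight of the root, so all growth
sequences are equally likely. The final set is accepted with probability inversely proportional to
the number of its growth sequences, which makes all `k`-graphlets equally likely. An alive vertex of
degree `d` lies in at least `k ^ (-2 * k) * d ^ (k - 1)` graphlets, whence a trial succeeds with
probability at least `k ^ (-O(k))`.

As many trials as fit into `M` words are run in parallel. The adversary may correlate the orders of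
the passes with the memory, but the law of one growth pass does not depend on the order. Hence, for
each class and each direction, the expected final value of a product of exponential weights of the
outcomes is a martingale; Markov's inequality and a union bound over the classes give the accuracy.
-/

noncomputable section

namespace GraphletStream

open scoped NNReal ENNReal Classical Finset

/-! ### Expectations and independent draws -/

section Expectation

variable {X Y Z : Type*}

/-- The expectation of an extended nonnegative function under a discrete law. -/
def expect (p : PMF X) (f : X → ℝ≥0∞) : ℝ≥0∞ := ∑' x, p x * f x

lemma expect_pure (x : X) (f : X → ℝ≥0∞) : expect (PMF.pure x) f = f x := by
  rw [expect, tsum_eq_single x fun y hy => by simp [PMF.pure_apply, hy]]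
  simp

lemma expect_bind (p : PMF X) (q : X → PMF Y) (f : Y → ℝ≥0∞) :
    expect (p.bind q) f = expect p fun x => expect (q x) f := by
  simp only [expect, PMF.bind_apply, ← ENNReal.tsum_mul_right, ← ENNReal.tsum_mul_left]
  rw [ENNReal.tsum_comm]
  simp only [mul_assoc]

lemma expect_map (p : PMF X) (g : X → Y) (f : Y → ℝ≥0∞) :
    expect (p.map g) f = expect p fun x => f (g x) := by
  simp [PMF.map, expect_bind, expect_pure]

lemma expect_mono (p : PMF X) {f g : X → ℝ≥0∞} (h : ∀ x ∈ p.support, f x ≤ g x) :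
    expect p f ≤ expect p g := by
  refine ENNReal.tsum_le_tsum fun x => ?_
  by_cases hx : x ∈ p.support
  · exact mul_le_mul_right (h x hx) _
  · simp [(PMF.apply_eq_zero_iff p x).2 hx]

lemma expect_congr (p : PMF X) {f g : X → ℝ≥0∞} (h : ∀ x ∈ p.support, f x = g x) :
    expect p f = expect p g :=
  le_antisymm (expect_mono p fun x hx => (h x hx).le) (expect_mono p fun x hx => (h x hx).ge)

lemma expect_const (p : PMF X) (a : ℝ≥0∞) : expect p (fun _ => a) = a := by
  rw [expect, ENNReal.tsum_mul_right, p.tsum_coe, one_mul]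

lemma expect_const_mul (p : PMF X) (a : ℝ≥0∞) (f : X → ℝ≥0∞) :
    expect p (fun x => a * f x) = a * expect p f := by
  simp only [expect, ← ENNReal.tsum_mul_left, mul_left_comm]

lemma expect_mul_const (p : PMF X) (a : ℝ≥0∞) (f : X → ℝ≥0∞) :
    expect p (fun x => f x * a) = expect p f * a := by
  simp only [mul_comm _ a, expect_const_mul]

lemma expect_add (p : PMF X) (f g : X → ℝ≥0∞) :
    expect p (fun x => f x + g x) = expect p f + expect p g := by
  simp only [expect, mul_add, ENNReal.tsum_add]

lemma expect_sum {ι : Type*} (p : PMF X) (s : Finset ι) (f : ι → X → ℝ≥0∞) :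
    expect p (fun x => ∑ i ∈ s, f i x) = ∑ i ∈ s, expect p (f i) := by
  simp only [expect, Finset.mul_sum]
  exact Summable.tsum_finsetSum fun _ _ => ENNReal.summable

lemma expect_ite_eq (p : PMF X) (a : X) : expect p (fun x => if x = a then 1 else 0) = p a := by
  rw [expect, tsum_eq_single a fun y hy => by simp [hy]]
  simp

lemma expect_fintype [Fintype X] (p : PMF X) (f : X → ℝ≥0∞) :
    expect p f = ∑ x, p x * f x := tsum_fintype _

lemma le_expect (p : PMF X) {f : X → ℝ≥0∞} {a : ℝ≥0∞} (h : ∀ x ∈ p.support, a ≤ f x) :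
    a ≤ expect p f := (expect_const p a).symm.le.trans (expect_mono p h)

/-- Markov's inequality. -/
lemma toOuterMeasure_le_expect (p : PMF X) {s : Set X} {f : X → ℝ≥0∞} (h : ∀ x ∈ s, 1 ≤ f x) :
    p.toOuterMeasure s ≤ expect p f := by
  rw [PMF.toOuterMeasure_apply]
  refine ENNReal.tsum_le_tsum fun x => ?_
  by_cases hx : x ∈ s
  · rw [Set.indicator_of_mem hx]
    exact le_mul_of_one_le_right' (h x hx)
  · simp [hx]

lemma one_sub_le_toOuterMeasure (p : PMF X) {s : Set X} {ε : ℝ≥0∞}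
    (h : p.toOuterMeasure sᶜ ≤ ε) : 1 - ε ≤ p.toOuterMeasure s := by
  have h_univ : p.toOuterMeasure (s ∪ sᶜ) = 1 :=
    (p.toOuterMeasure_apply_eq_one_iff _).2 (by simp)
  rw [tsub_le_iff_right, ← h_univ]
  exact (MeasureTheory.measure_union_le s sᶜ).trans (by gcongr)

lemma bind_congr {p : PMF X} {f g : X → PMF Y} (h : ∀ x ∈ p.support, f x = g x) :
    p.bind f = p.bind g := by
  ext y
  simp only [PMF.bind_apply]
  refine tsum_congr fun x => ?_
  by_cases hx : x ∈ p.support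
  · rw [h x hx]
  · simp [(PMF.apply_eq_zero_iff p x).2 hx]

/-- The law of a list of independent values, one drawn from `f x` for each entry `x`. -/
def drawList (f : X → PMF Y) : List X → PMF (List Y)
  | [] => PMF.pure []
  | x :: xs => (f x).bind fun y => (drawList f xs).map (y :: ·)

lemma expect_drawList_prod (f : X → PMF Y) (h : Y → ℝ≥0∞) (xs : List X) :
    expect (drawList f xs) (fun ys => (ys.map h).prod) =
      (xs.map fun x => expect (f x) h).prod := by
  induction xs with
  | nil => simp [drawList, expect_pure]
  | cons x xs ih =>
    simp only [drawList, expect_bind, expect_map, List.map_cons, List.prod_cons,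
      expect_const_mul, ih, expect_mul_const]

lemma length_of_mem_support_drawList {f : X → PMF Y} {xs : List X} {ys : List Y}
    (h : ys ∈ (drawList f xs).support) : ys.length = xs.length := by
  induction xs generalizing ys with
  | nil => simp_all [drawList]
  | cons x xs ih =>
    simp only [drawList, PMF.mem_support_bind_iff, PMF.mem_support_map_iff] at h
    obtain ⟨y, -, zs, hzs, rfl⟩ := h
    simp [ih hzs]

lemma exists_of_mem_support_drawList {f : X → PMF Y} {xs : List X} {ys : List Y}
    (h : ys ∈ (drawList f xs).support) {y : Y} (hy : y ∈ ys) : ∃ x ∈ xs, y ∈ (f x).support := by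
  induction xs generalizing ys with
  | nil => simp_all [drawList]
  | cons x xs ih =>
    simp only [drawList, PMF.mem_support_bind_iff, PMF.mem_support_map_iff] at h
    obtain ⟨z, hz, zs, hzs, rfl⟩ := h
    rcases List.mem_cons.1 hy with rfl | hy
    · exact ⟨x, List.mem_cons_self, hz⟩
    · obtain ⟨x', hx', hyx'⟩ := ih hzs hy
      exact ⟨x', List.mem_cons_of_mem _ hx', hyx'⟩

lemma drawList_bind (f : X → PMF Y) (g : Y → PMF Z) (xs : List X) :
    (drawList f xs).bind (drawList g) = drawList (fun x => (f x).bind g) xs := by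
  induction xs with
  | nil => simp [drawList]
  | cons x xs ih =>
    simp only [drawList, PMF.bind_bind, PMF.bind_map, Function.comp_def, ← ih, PMF.map_bind]
    refine congrArg _ (funext fun y => ?_)
    rw [PMF.bind_comm]

lemma drawList_comp (f : Y → PMF Z) (h : X → Y) (xs : List X) :
    drawList f (xs.map h) = drawList (fun x => f (h x)) xs := by
  induction xs with
  | nil => rfl
  | cons x xs ih => simp only [List.map_cons, drawList, ih]

lemma drawList_congr {f g : X → PMF Y} {xs : List X} (h : ∀ x ∈ xs, f x = g x) :
    drawList f xs = drawList g xs := by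
  induction xs with
  | nil => rfl
  | cons x xs ih => simp only [drawList, h x (by simp), ih fun z hz => h z (by simp [hz])]

/-- The law of the state that is reached from a given one when the entries of a list are processed
in turn by the random update `f`. -/
def drawFold (f : X → Y → PMF X) : List Y → X → PMF X
  | [], x => PMF.pure x
  | y :: ys, x => (f x y).bind (drawFold f ys)

lemma drawFold_eq_pure_foldl {f : X → Y → PMF X} {upd : X → Y → X}
    (h : ∀ x y, f x y = PMF.pure (upd x y)) (ys : List Y) (x : X) :
    drawFold f ys x = PMF.pure (ys.foldl upd x) := by
  induction ys generalizing x with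
  | nil => rfl
  | cons y ys ih => simp [drawFold, h, PMF.pure_bind, ih]

lemma support_drawFold_subset {f : X → Y → PMF X} {S : Set X}
    (h : ∀ x ∈ S, ∀ y, (f x y).support ⊆ S) (ys : List Y) {x : X} (hx : x ∈ S) :
    (drawFold f ys x).support ⊆ S := by
  induction ys generalizing x with
  | nil => simpa [drawFold] using hx
  | cons y ys ih =>
    intro z hz
    simp only [drawFold, PMF.mem_support_bind_iff] at hz
    obtain ⟨x', hx', hz⟩ := hz
    exact ih (h x hx y hx') hz

lemma drawFold_drawList (f : X → Y → PMF X) (ys : List Y) (xs : List X) :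
    drawFold (fun xs y => drawList (f · y) xs) ys xs = drawList (drawFold f ys) xs := by
  induction ys generalizing xs with
  | nil =>
    induction xs with
    | nil => rfl
    | cons x xs ih =>
      simp only [drawFold, drawList, PMF.pure_bind] at ih ⊢
      rw [← ih, PMF.pure_map]
  | cons y ys ih => simp only [drawFold, funext ih, drawList_bind]

lemma drawFold_filterMap (f : X → Z → PMF X) (g : Y → Option Z) (ys : List Y) (x : X) :
    drawFold (fun x y => (g y).elim (PMF.pure x) (f x)) ys x = drawFold f (ys.filterMap g) x := by
  induction ys generalizing x with
  | nil => rfl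
  | cons y ys ih => cases h : g y <;> simp [drawFold, h, PMF.pure_bind, funext ih]

end Expectation

/-! ### Coding states by bit strings -/

/-- The elements of `S` can be told apart by `L` bits. -/
def Fits {X : Type*} (S : Set X) (L : ℕ) : Prop := S.encard ≤ 2 ^ L

/-- A coding of the elements of `S` by bit strings of length `L`. The maps are total, but decoding
is only required to invert the encoding on `S`. -/
structure Coding {X : Type*} (S : Set X) (L : ℕ) where
  enc : X → Memory
  dec : Memory → X
  dec_enc : ∀ x ∈ S, dec (enc x) = x
  length_enc : ∀ x, (enc x).length = L

namespace Fits

variable {X Y : Type*} {S T : Set X} {U : Set Y} {L L' : ℕ}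

lemma mono (h : Fits T L) (hST : S ⊆ T) (hL : L ≤ L') : Fits S L' :=
  (Set.encard_le_encard hST).trans (h.trans (pow_le_pow_right₀ one_le_two hL))

lemma image (h : Fits S L) (g : X → Y) : Fits (g '' S) L := (Set.encard_image_le g S).trans h

lemma sigma {T : X → Set Y} (h : Fits S L) (h' : ∀ x ∈ S, Fits (T x) L') :
    Fits {p : X × Y | p.1 ∈ S ∧ p.2 ∈ T p.1} (L + L') := by
  obtain ⟨hS, hcard⟩ : S.Finite ∧ S.ncard ≤ 2 ^ L :=
    Set.encard_le_coe_iff_finite_ncard_le.1 (by exact_mod_cast h)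
  lift S to Finset X using hS
  have h_union : {p : X × Y | p.1 ∈ (S : Set X) ∧ p.2 ∈ T p.1} = ⋃ x ∈ S, Prod.mk x '' T x := by
    ext ⟨x, y⟩
    simp [and_comm]
  rw [Fits, h_union]
  calc _ ≤ ∑ x ∈ S, (Prod.mk x '' T x).encard := Finset.set_encard_biUnion_le _ _
    _ ≤ ∑ _x ∈ S, 2 ^ L' := Finset.sum_le_sum fun x hx => (h' x hx).image _
    _ = #S * 2 ^ L' := by rw [Finset.sum_const, nsmul_eq_mul]
    _ ≤ 2 ^ (L + L') := by
      rw [pow_add]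
      gcongr
      rw [Set.ncard_coe_finset] at hcard
      exact_mod_cast hcard

lemma prod (h : Fits S L) (h' : Fits U L') : Fits (S ×ˢ U) (L + L') :=
  h.sigma fun _ _ => h'

lemma sum (h : Fits S L) (h' : Fits U L') :
    Fits {s : X ⊕ Y | Sum.elim (· ∈ S) (· ∈ U) s} (L + L' + 1) := by
  have h_union : {s : X ⊕ Y | Sum.elim (· ∈ S) (· ∈ U) s} = Sum.inl '' S ∪ Sum.inr '' U := by
    ext (x | y) <;> simp
  rw [Fits, h_union]
  calc _ ≤ S.encard + U.encard := (Set.encard_union_le _ _).trans <|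
        add_le_add (Set.encard_image_le _ _) (Set.encard_image_le _ _)
    _ ≤ 2 ^ (L + L') + 2 ^ (L + L') := add_le_add
        (h.trans (pow_le_pow_right₀ one_le_two (by omega)))
        (h'.trans (pow_le_pow_right₀ one_le_two (by omega)))
    _ = 2 ^ (L + L' + 1) := by rw [pow_succ, mul_two]

lemma pi {ι : Type*} [Fintype ι] (h : Fits S L) :
    Fits {f : ι → X | ∀ i, f i ∈ S} (Fintype.card ι * L) := by
  have h_pi : {f : ι → X | ∀ i, f i ∈ S} = Set.univ.pi fun _ => S := by ext; simp
  rw [Fits, h_pi, Set.encard_pi_eq_prod_encard, Finset.prod_const, Finset.card_univ, mul_comm,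
    pow_mul]
  exact pow_le_pow_left' h _

lemma list (b : ℕ) (h : Fits S L) : Fits {l : List X | l.length = b ∧ ∀ x ∈ l, x ∈ S} (b * L) := by
  have h_pi := (h.pi (ι := Fin b)).image List.ofFn
  rw [Fintype.card_fin] at h_pi
  refine h_pi.mono ?_ le_rfl
  rintro l ⟨rfl, hl⟩
  exact ⟨l.get, fun i => hl _ (l.get_mem i), List.ofFn_get l⟩

lemma finset {A : Finset X} (h : #A ≤ 2 ^ L) : Fits (A : Set X) L := by
  rw [Fits, Set.encard_coe_eq_coe_finsetCard]
  exact_mod_cast h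

lemma nat_lt {m : ℕ} (h : m ≤ 2 ^ L) : Fits {i : ℕ | i < m} L :=
  (finset (A := Finset.range m) (by simpa using h)).mono (fun i hi => by simpa using hi) le_rfl

lemma nonempty_coding [Nonempty X] (h : Fits S L) : Nonempty (Coding S L) := by
  have hS : S.Finite ∧ S.ncard ≤ 2 ^ L :=
    Set.encard_le_coe_iff_finite_ncard_le.1 (by exact_mod_cast h)
  have := hS.1.fintype
  obtain ⟨e⟩ : Nonempty (S ↪ (Fin L → Bool)) := Function.Embedding.nonempty_of_card_le (by
    simpa [← Set.ncard_eq_toFinset_card'] using hS.2)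
  set enc : X → Memory := fun x => List.ofFn (Function.extend Subtype.val e (fun _ _ => false) x)
  have h_inj : Set.InjOn enc S := by
    intro x hx y hy hxy
    have hxy' : Function.extend Subtype.val e _ (⟨x, hx⟩ : S).1 =
        Function.extend Subtype.val e _ (⟨y, hy⟩ : S).1 := List.ofFn_injective hxy
    rw [Subtype.val_injective.extend_apply, Subtype.val_injective.extend_apply] at hxy'
    exact congrArg Subtype.val (e.injective hxy')
  exact ⟨enc, Function.invFunOn enc S, fun x hx => h_inj.leftInvOn_invFunOn hx,
    fun x => List.length_ofFn⟩

end Fits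

/-! ### Streaming machines with abstract states -/

/-- A phase whose states range over an arbitrary type instead of bit strings. It knows the number
`left x` of passes that are still to be made from the state `x`, and it halts when this is `0`. -/
structure Machine (n : ℕ) (σ : Type) where
  step : σ → Sym2 (Fin n) → PMF σ
  endPass : σ → PMF σ
  left : σ → ℕ

namespace Machine

variable {n : ℕ} {σ : Type}

/-- One pass over the edge list `l`. -/
def pass (A : Machine n σ) (l : List (Sym2 (Fin n))) (x : σ) : PMF σ :=
  (drawFold A.step l x).bind A.endPass

/-- The phase that carries out a machine on coded states. -/
def toPhase (A : Machine n σ) {S : Set σ} {L : ℕ} (K : Coding S L) (start : Memory → PMF σ) :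
    Phase n where
  start m := (start m).map K.enc
  halt m := A.left (K.dec m) == 0
  step m e := (A.step (K.dec m) e).map K.enc
  endPass m := (A.endPass (K.dec m)).map K.enc

/-- No transition leaves the set `S` of states. -/
def Closed (A : Machine n σ) (S : Set σ) : Prop :=
  (∀ x ∈ S, ∀ e, (A.step x e).support ⊆ S) ∧ ∀ x ∈ S, (A.endPass x).support ⊆ S

/-- The property `P` of states survives every pass over the edges of `G`, and each such pass uses
up one of the passes that are left. -/
def IsInvariant (A : Machine n σ) (G : SimpleGraph (Fin n)) (P : σ → Prop) : Prop :=
  ∀ x, P x → A.left x ≠ 0 → ∀ l, IsEdgeStream G l →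
    ∀ y ∈ (A.pass l x).support, P y ∧ A.left y + 1 = A.left x

variable {A : Machine n σ} {S : Set σ} {L : ℕ}

lemma Closed.support_pass_subset (h : A.Closed S) (l : List (Sym2 (Fin n))) {x : σ} (hx : x ∈ S) :
    (A.pass l x).support ⊆ S := by
  intro y hy
  simp only [pass, PMF.mem_support_bind_iff] at hy
  obtain ⟨z, hz, hy⟩ := hy
  exact h.2 z (support_drawFold_subset h.1 l hx hz) hy

section toPhase

variable {K : Coding S L} {start : Memory → PMF σ} {x : σ} {p q : ℕ}

lemma scan_toPhase (hA : A.Closed S) (hx : x ∈ S) (hq : L ≤ q) (l : List (Sym2 (Fin n))) :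
    (A.toPhase K start).scan l ⟨K.enc x, p, q⟩ =
      (drawFold A.step l x).map fun y => ⟨K.enc y, p, q⟩ := by
  induction l generalizing x with
  | nil => simp [Phase.scan, drawFold, PMF.pure_map]
  | cons e es ih =>
    have h_step : (A.toPhase K start).step (K.enc x) e = (A.step x e).map K.enc := by
      simp [toPhase, K.dec_enc x hx]
    simp only [Phase.scan, drawFold, h_step, PMF.map_bind, PMF.bind_map, PMF.map_comp]
    refine bind_congr fun y hy => ?_
    simpa [Config.store, K.length_enc, hq] using ih (hA.1 x hx e hy)

lemma pass_toPhase (hA : A.Closed S) (hx : x ∈ S) (hq : L ≤ q) (l : List (Sym2 (Fin n))) :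
    (A.toPhase K start).pass l ⟨K.enc x, p, q⟩ =
      (A.pass l x).map fun y => ⟨K.enc y, p + 1, q⟩ := by
  rw [Phase.pass, scan_toPhase hA hx hq, pass, PMF.bind_map, PMF.map_bind]
  refine bind_congr fun y hy => ?_
  simp [toPhase, K.dec_enc y (support_drawFold_subset hA.1 l hx hy), PMF.map_comp,
    Function.comp_def, Config.store, K.length_enc, hq]

lemma halt_toPhase (hx : x ∈ S) : (A.toPhase K start).halt (K.enc x) = true ↔ A.left x = 0 := by
  simp [toPhase, K.dec_enc x hx]

variable {G : SimpleGraph (Fin n)} {order : Config → List (Sym2 (Fin n))} {P : σ → Prop}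
  {Ψ : σ → ℝ≥0∞}

lemma mem_support_runFrom_toPhase (hA : A.Closed S) (hP : A.IsInvariant G P)
    (horder : ∀ s, IsEdgeStream G (order s)) {N : ℕ} (hx : x ∈ S) (hPx : P x) (hq : L ≤ q)
    (hN : A.left x ≤ N) {t : Config}
    (ht : t ∈ ((A.toPhase K start).runFrom order N ⟨K.enc x, p, q⟩).support) :
    ∃ y ∈ S, P y ∧ A.left y = 0 ∧ t = ⟨K.enc y, p + A.left x, q⟩ := by
  induction N generalizing x p with
  | zero =>
    have hx0 : A.left x = 0 := Nat.le_zero.1 hN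
    exact ⟨x, hx, hPx, hx0, by simpa [Phase.runFrom, hx0] using ht⟩
  | succ N ih =>
    by_cases hx0 : A.left x = 0
    · simp only [Phase.runFrom, if_pos ((halt_toPhase hx).2 hx0)] at ht
      exact ⟨x, hx, hPx, hx0, by simpa [hx0] using ht⟩
    · simp only [Phase.runFrom, if_neg (mt (halt_toPhase hx).1 hx0), pass_toPhase hA hx hq,
        PMF.bind_map, PMF.mem_support_bind_iff] at ht
      obtain ⟨y, hy, ht⟩ := ht
      obtain ⟨hPy, hxy⟩ := hP x hPx hx0 _ (horder _) y hy
      obtain ⟨z, hz, hPz, hz0, rfl⟩ :=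
        ih (hA.support_pass_subset _ hx hy) hPy (by omega) ht
      exact ⟨z, hz, hPz, hz0, by rw [← hxy, add_assoc, add_comm 1]⟩

lemma expect_runFrom_toPhase_le (hA : A.Closed S) (hP : A.IsInvariant G P)
    (horder : ∀ s, IsEdgeStream G (order s))
    (hΨ : ∀ x, P x → A.left x ≠ 0 → ∀ l, IsEdgeStream G l → expect (A.pass l x) Ψ ≤ Ψ x)
    (N : ℕ) (hx : x ∈ S) (hPx : P x) (hq : L ≤ q) :
    expect ((A.toPhase K start).runFrom order N ⟨K.enc x, p, q⟩) (fun t => Ψ (K.dec t.mem)) ≤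
      Ψ x := by
  induction N generalizing x p with
  | zero => simp [Phase.runFrom, expect_pure, K.dec_enc x hx]
  | succ N ih =>
    by_cases hx0 : A.left x = 0
    · simp [Phase.runFrom, halt_toPhase hx, hx0, expect_pure, K.dec_enc x hx]
    · simp only [Phase.runFrom, if_neg (mt (halt_toPhase hx).1 hx0), pass_toPhase hA hx hq,
        expect_bind, expect_map]
      refine (expect_mono _ fun y hy => ?_).trans (hΨ x hPx hx0 _ (horder _))
      exact ih (hA.support_pass_subset _ hx hy) (hP x hPx hx0 _ (horder _) y hy).1

lemma mem_support_run_toPhase (hA : A.Closed S) (hP : A.IsInvariant G P)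
    (horder : ∀ s, IsEdgeStream G (order s)) {m : Memory} {N Q : ℕ}
    (hstart : ∀ x ∈ (start m).support, x ∈ S ∧ P x ∧ A.left x = Q) (hN : Q ≤ N) {t : Config}
    (ht : t ∈ ((A.toPhase K start).run order N m).support) :
    ∃ y ∈ S, P y ∧ A.left y = 0 ∧ t = ⟨K.enc y, Q, max m.length L⟩ := by
  simp only [Phase.run, toPhase, PMF.bind_map, PMF.mem_support_bind_iff, Function.comp_apply,
    K.length_enc] at ht
  obtain ⟨x, hx, ht⟩ := ht
  obtain ⟨hxS, hPx, rfl⟩ := hstart x hx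
  simpa using mem_support_runFrom_toPhase hA hP horder hxS hPx (le_max_right _ _) hN ht

lemma expect_run_toPhase_le (hA : A.Closed S) (hP : A.IsInvariant G P)
    (horder : ∀ s, IsEdgeStream G (order s))
    (hΨ : ∀ x, P x → A.left x ≠ 0 → ∀ l, IsEdgeStream G l → expect (A.pass l x) Ψ ≤ Ψ x)
    {m : Memory} (N : ℕ) (hstart : ∀ x ∈ (start m).support, x ∈ S ∧ P x) :
    expect ((A.toPhase K start).run order N m) (fun t => Ψ (K.dec t.mem)) ≤
      expect (start m) Ψ := by
  have h_map : (A.toPhase K start).start m = (start m).map K.enc := rfl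
  rw [Phase.run, h_map, PMF.bind_map, expect_bind]
  refine expect_mono _ fun x hx => ?_
  exact expect_runFrom_toPhase_le hA hP horder hΨ N (hstart x hx).1 (hstart x hx).2
    (by simp [K.length_enc])

end toPhase

end Machine

/-! ### Graphlets and their classes -/

section Graphlets

variable {n k : ℕ} {G H : SimpleGraph (Fin n)} {S : Finset (Fin n)}

/-- The vertex sets of the `k`-graphlets of `G`. -/
def graphlets (G : SimpleGraph (Fin n)) (k : ℕ) : Finset (Finset (Fin n)) :=
  {S | #S = k ∧ (G.induce (S : Set (Fin n))).Connected}

lemma mem_graphlets : S ∈ graphlets G k ↔ #S = k ∧ (G.induce (S : Set (Fin n))).Connected := by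
  simp [graphlets]

/-- The class of the subgraph of `G` induced by `S`, or `none` if `S` is not a `k`-graphlet. -/
def classOf (k : ℕ) (G : SimpleGraph (Fin n)) (S : Finset (Fin n)) : Option (GraphletClass k) :=
  if h : ∃ i : GraphletClass k, Nonempty (G.induce (S : Set (Fin n)) ≃g i.rep) then some h.choose
  else none

lemma classOf_eq_some_iff {i : GraphletClass k} :
    classOf k G S = some i ↔ Nonempty (G.induce (S : Set (Fin n)) ≃g i.rep) := by
  unfold classOf
  split_ifs with h
  · rw [Option.some_inj]
    refine ⟨fun hi => hi ▸ h.choose_spec, fun ⟨f⟩ => ?_⟩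
    obtain ⟨g⟩ := h.choose_spec
    exact Quotient.out_equiv_out.1 ⟨g.symm.trans f⟩
  · simpa only [reduceCtorEq, false_iff] using fun hi => h ⟨i, hi⟩

lemma classOf_congr (h : ∀ a ∈ S, ∀ b ∈ S, G.Adj a b ↔ H.Adj a b) :
    classOf k G S = classOf k H S := by
  have h_induce : G.induce (S : Set (Fin n)) = H.induce (S : Set (Fin n)) := by
    ext a b
    exact h a a.2 b b.2
  rw [classOf, h_induce, classOf]

lemma exists_classOf_eq_some_iff : (∃ i, classOf k G S = some i) ↔ S ∈ graphlets G k := by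
  simp only [classOf_eq_some_iff, mem_graphlets]
  constructor
  · rintro ⟨i, ⟨f⟩⟩
    exact ⟨by simpa using Fintype.card_congr f.toEquiv, f.connected_iff.2 (Quotient.out i).2⟩
  · rintro ⟨h_card, h_conn⟩
    let e : (S : Set (Fin n)) ≃ Fin k := Fintype.equivFinOfCardEq (by simpa using h_card)
    let f : G.induce (S : Set (Fin n)) ≃g (G.induce (S : Set (Fin n))).map e.toEmbedding :=
      SimpleGraph.Iso.map e _
    obtain ⟨g⟩ := Setoid.symm (Quotient.mk_out (s := graphletSetoid k)
      ⟨_, f.connected_iff.1 h_conn⟩)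
    exact ⟨_, ⟨f.trans g⟩⟩

lemma graphletCount_eq_card (i : GraphletClass k) :
    graphletCount G i = #{S ∈ graphlets G k | classOf k G S = some i} := by
  rw [graphletCount, ← Set.ncard_coe_finset]
  congr 1
  ext S
  simp only [Set.mem_ofPred_eq, Finset.coe_filter, ← classOf_eq_some_iff]
  exact ⟨fun h => ⟨exists_classOf_eq_some_iff.1 ⟨i, h⟩, h⟩, fun h => h.2⟩

lemma sum_graphlets (G : SimpleGraph (Fin n)) (f : Option (GraphletClass k) → ℝ) :
    ∑ S ∈ graphlets G k, f (classOf k G S) = ∑ i, graphletCount G i * f (some i) := by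
  have h_class : ∀ S ∈ graphlets G k, f (classOf k G S) =
      ∑ i, if classOf k G S = some i then f (some i) else 0 := by
    intro S hS
    obtain ⟨i, hi⟩ := exists_classOf_eq_some_iff.2 hS
    simp [hi]
  rw [Finset.sum_congr rfl h_class, Finset.sum_comm]
  refine Finset.sum_congr rfl fun i _ => ?_
  rw [← Finset.sum_filter, Finset.sum_const, graphletCount_eq_card, nsmul_eq_mul]

lemma numGraphlets_eq_card (G : SimpleGraph (Fin n)) : numGraphlets k G = #(graphlets G k) := by
  have h_sum := sum_graphlets (k := k) G fun _ => 1
  simp only [Finset.sum_const, nsmul_eq_mul, mul_one] at h_sum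
  exact_mod_cast h_sum.symm

lemma card_graphletClass_le (k : ℕ) : Fintype.card (GraphletClass k) ≤ 2 ^ (k * k) :=
  calc Fintype.card (GraphletClass k) ≤ Fintype.card {H : SimpleGraph (Fin k) // H.Connected} :=
        Fintype.card_le_of_surjective (Quotient.mk (graphletSetoid k)) Quotient.mk_surjective
    _ ≤ Fintype.card (Fin k → Fin k → Prop) :=
        Fintype.card_le_of_injective (fun H => H.1.Adj) fun _ _ h =>
          Subtype.ext (SimpleGraph.ext h)
    _ = 2 ^ (k * k) := by simp [pow_mul]

/-- The graph on `k` vertices in which each of the vertices up to `j` is joined to all others and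
there are no further edges. These graphs have different numbers of edges for `j + 1 < k`, so they
show that there are at least `k - 1` classes of graphlets. -/
def splitGraph (k j : ℕ) : SimpleGraph (Fin k) where
  Adj a b := a ≠ b ∧ (a.1 ≤ j ∨ b.1 ≤ j)
  symm := ⟨fun _ _ h => ⟨h.1.symm, h.2.symm⟩⟩
  loopless := ⟨fun _ h => h.1 rfl⟩

lemma splitGraph_connected (hk : 0 < k) (j : ℕ) : (splitGraph k j).Connected := by
  refine (SimpleGraph.connected_iff_exists_forall_reachable _).2 ⟨⟨0, hk⟩, fun w => ?_⟩
  by_cases h : (⟨0, hk⟩ : Fin k) = w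
  · exact h ▸ SimpleGraph.Reachable.refl _
  · exact SimpleGraph.Adj.reachable ⟨h, Or.inl (Nat.zero_le _)⟩

lemma splitGraph_lt {i j : ℕ} (hij : i < j) (hj : j + 1 < k) :
    splitGraph k i < splitGraph k j := by
  refine lt_of_le_of_ne (fun a b h => ⟨h.1, h.2.imp (by omega) (by omega)⟩) fun h => ?_
  have h_adj : (splitGraph k j).Adj ⟨j, by omega⟩ ⟨j + 1, hj⟩ := ⟨by simp, Or.inl le_rfl⟩
  rw [← h] at h_adj
  rcases h_adj.2 with h' | h' <;> simp only at h' <;> omega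

lemma sub_one_le_card_graphletClass (k : ℕ) : k - 1 ≤ Fintype.card (GraphletClass k) := by
  rcases Nat.eq_zero_or_pos k with rfl | hk
  · simp
  let f : Fin (k - 1) → GraphletClass k := fun j => ⟦⟨splitGraph k j, splitGraph_connected hk j⟩⟧
  have h_ne : ∀ i j : Fin (k - 1), i < j → f i ≠ f j := by
    intro i j hij h
    obtain ⟨e⟩ : Nonempty (splitGraph k i ≃g splitGraph k j) := Quotient.exact h
    have h_lt := Finset.card_lt_card (SimpleGraph.edgeFinset_ssubset_edgeFinset.2
      (splitGraph_lt (k := k) hij (by omega)))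
    exact h_lt.ne (by convert e.card_edgeFinset_eq)
  have hf : Function.Injective f := fun i j h => by
    by_contra hij
    rcases lt_or_gt_of_ne hij with hij | hij
    · exact h_ne i j hij h
    · exact h_ne j i hij h.symm
  simpa using Fintype.card_le_of_injective f hf

end Graphlets

/-! ### The degree profile -/

section Connectivity

variable {V : Type*} {G : SimpleGraph V} {T : Set V} {a b u v : V}

lemma exists_adj_of_reachable (h : G.Reachable v u) (hv : v ∈ T) (hu : u ∉ T) :
    ∃ a ∈ T, ∃ b ∉ T, G.Adj a b := by
  obtain ⟨p⟩ := h
  obtain ⟨d, -, h_fst, h_snd⟩ := p.exists_boundary_dart T hv hu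
  exact ⟨_, h_fst, _, h_snd, d.adj⟩

lemma induce_insert_connected (hT : (G.induce T).Connected) (ha : a ∈ T) (hab : G.Adj a b) :
    (G.induce (insert b T)).Connected := by
  rw [Set.insert_eq, Set.union_comm]
  exact SimpleGraph.connected_induce_union hT.preconnected
    (by simp) ha (Set.mem_singleton b) hab

end Connectivity

lemma pow_le_mul_choose {d r : ℕ} (h : r ≤ d) : d ^ r ≤ r ^ r * r.factorial * d.choose r := by
  rcases Nat.eq_zero_or_pos r with rfl | hr
  · simp
  have h_mul : d ≤ r * (d + 1 - r) := by
    obtain ⟨e, rfl⟩ := Nat.exists_eq_add_of_le h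
    rw [show r + e + 1 - r = e + 1 by omega]
    nlinarith
  calc d ^ r ≤ (r * (d + 1 - r)) ^ r := Nat.pow_le_pow_left h_mul r
    _ = r ^ r * (d + 1 - r) ^ r := Nat.mul_pow _ _ _
    _ ≤ r ^ r * d.descFactorial r := Nat.mul_le_mul_left _ (Nat.pow_sub_le_descFactorial d r)
    _ = _ := by rw [Nat.descFactorial_eq_factorial_mul_choose, mul_assoc]

section Profile

variable {n k : ℕ} {G : SimpleGraph (Fin n)} {v w : Fin n} {S T : Finset (Fin n)}

/-- The vertex `v` lies in a component with at least `k` vertices, which means that it belongs to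
some `k`-graphlet. -/
def Alive (G : SimpleGraph (Fin n)) (k : ℕ) (v : Fin n) : Prop := k ≤ #{u | G.Reachable v u}

/-- The degrees of the alive vertices; the other vertices get the value `0`. This is all that the
sampling phase has to know about `G` in advance. -/
def profile (G : SimpleGraph (Fin n)) (k : ℕ) (v : Fin n) : ℕ :=
  if Alive G k v then G.degree v else 0

lemma Alive.of_reachable (h : Alive G k v) (hvw : G.Reachable v w) : Alive G k w := by
  refine le_trans h (Finset.card_le_card fun u hu => ?_)
  simp only [Finset.mem_filter, Finset.mem_univ, true_and] at hu ⊢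
  exact hvw.symm.trans hu

lemma alive_of_mem_graphlets (hS : S ∈ graphlets G k) (hv : v ∈ S) : Alive G k v := by
  obtain ⟨rfl, h_conn⟩ := mem_graphlets.1 hS
  refine Finset.card_le_card fun w hw => ?_
  have h_reach : G.Reachable v w := (h_conn.preconnected ⟨v, hv⟩ ⟨w, hw⟩).map
    (SimpleGraph.Embedding.induce (S : Set (Fin n))).toHom
  simpa using h_reach

lemma Alive.exists_adj (h : Alive G k v) (hv : v ∈ T) (hT : #T < k) :
    ∃ a ∈ T, ∃ b ∉ T, G.Adj a b := by
  obtain ⟨u, hu, huT⟩ := Finset.exists_mem_notMem_of_card_lt_card (lt_of_lt_of_le hT h)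
  exact exists_adj_of_reachable (T := (T : Set (Fin n))) (by simpa using hu) hv huT

lemma Alive.exists_graphlet (h : Alive G k v) (hk : 1 ≤ k) : ∃ S ∈ graphlets G k, v ∈ S := by
  have h_grow : ∀ i, i + 1 ≤ k → ∃ T : Finset (Fin n), #T = i + 1 ∧ v ∈ T ∧
      (G.induce (T : Set (Fin n))).Connected := by
    intro i
    induction i with
    | zero => exact fun _ => ⟨{v}, by simp, by simp, by
        rw [Finset.coe_singleton]; simp⟩
    | succ i ih =>
      intro hi
      obtain ⟨T, hT, hv, hc⟩ := ih (by omega)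
      obtain ⟨a, ha, b, hb, hab⟩ := h.exists_adj hv (by omega)
      exact ⟨insert b T, by rw [Finset.card_insert_of_notMem hb, hT], by simp [hv],
        by rw [Finset.coe_insert]; exact induce_insert_connected hc ha hab⟩
  obtain ⟨T, hT, hv, hc⟩ := h_grow (k - 1) (by omega)
  exact ⟨T, mem_graphlets.2 ⟨by omega, hc⟩, hv⟩

lemma Alive.degree_pos (h : Alive G k v) (hk : 2 ≤ k) : 0 < G.degree v := by
  obtain ⟨a, ha, b, hb, hab⟩ := h.exists_adj (T := {v}) (by simp)
    (by rw [Finset.card_singleton]; omega)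
  obtain rfl := Finset.mem_singleton.1 ha
  exact (G.degree_pos_iff_exists_adj a).2 ⟨b, hab⟩

lemma Alive.profile_eq (h : Alive G k v) : profile G k v = G.degree v := if_pos h

lemma Alive.profile_pos (h : Alive G k v) (hk : 2 ≤ k) : 0 < profile G k v := by
  rw [h.profile_eq]
  exact h.degree_pos hk

lemma alive_of_profile_pos (h : 0 < profile G k v) : Alive G k v := by
  by_contra h'
  simp [profile, h'] at h

lemma profile_le (G : SimpleGraph (Fin n)) (k : ℕ) (v : Fin n) : profile G k v ≤ n := by
  unfold profile
  split_ifs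
  · exact (G.degree_lt_card_verts v).le.trans (by simp)
  · exact Nat.zero_le _

lemma insert_mem_graphlets_of_subset_neighborFinset {A : Finset (Fin n)}
    (hA : A ⊆ G.neighborFinset v) (hk : #A + 1 = k) : insert v A ∈ graphlets G k := by
  have hv : v ∉ A := fun h => by simpa using hA h
  refine mem_graphlets.2 ⟨by rw [Finset.card_insert_of_notMem hv, hk], ?_⟩
  clear hk hv
  induction A using Finset.induction_on with
  | empty =>
    rw [insert_empty_eq, Finset.coe_singleton]
    simp
  | insert b A _ ih =>
    rw [Finset.insert_comm, Finset.coe_insert]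
    refine induce_insert_connected (a := v) (ih fun x hx => hA (by simp [hx])) (by simp) ?_
    simpa using hA (Finset.mem_insert_self b A)

lemma choose_degree_le_card_graphlets (hk : 1 ≤ k) (v : Fin n) :
    (G.degree v).choose (k - 1) ≤ #{S ∈ graphlets G k | v ∈ S} := by
  rw [← SimpleGraph.card_neighborFinset_eq_degree, ← Finset.card_powersetCard]
  refine Finset.card_le_card_of_injOn (insert v ·) ?_ ?_
  · intro A hA
    rw [Finset.mem_coe, Finset.mem_powersetCard] at hA
    rw [Finset.mem_coe, Finset.mem_filter]
    exact ⟨insert_mem_graphlets_of_subset_neighborFinset hA.1 (by omega),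
      Finset.mem_insert_self _ _⟩
  · refine (Finset.insert_erase_invOn (a := v)).2.injOn.mono fun A hA => ?_
    rw [Finset.mem_coe, Finset.mem_powersetCard] at hA
    exact fun h => by simpa using hA.1 h

lemma profile_pow_le (hk : 2 ≤ k) (v : Fin n) :
    profile G k v ^ (k - 1) ≤ k ^ (2 * k) * #{S ∈ graphlets G k | v ∈ S} := by
  by_cases hv : Alive G k v
  swap
  · simp [profile, hv, show k - 1 ≠ 0 by omega]
  rw [hv.profile_eq]
  have h_pow : (k - 1) ^ (k - 1) ≤ k ^ k :=
    (Nat.pow_le_pow_left k.pred_le _).trans (Nat.pow_le_pow_right (by omega) k.pred_le)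
  by_cases h_deg : k - 1 ≤ G.degree v
  · calc _ ≤ (k - 1) ^ (k - 1) * (k - 1).factorial * (G.degree v).choose (k - 1) :=
          pow_le_mul_choose h_deg
      _ ≤ k ^ k * k ^ k * #{S ∈ graphlets G k | v ∈ S} :=
          Nat.mul_le_mul (Nat.mul_le_mul h_pow ((Nat.factorial_le_pow _).trans h_pow))
            (choose_degree_le_card_graphlets (by omega) v)
      _ = _ := by rw [two_mul, pow_add]
  · obtain ⟨S, hS, hvS⟩ := hv.exists_graphlet (by omega)
    have h_card : 1 ≤ #{S ∈ graphlets G k | v ∈ S} := Finset.card_pos.2 ⟨S, by simp [hS, hvS]⟩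
    calc G.degree v ^ (k - 1) ≤ k ^ (k - 1) := Nat.pow_le_pow_left (by omega) _
      _ ≤ k ^ (2 * k) := Nat.pow_le_pow_right (by omega) (by omega)
      _ ≤ _ := Nat.le_mul_of_pos_right _ h_card

/-- The normalizing constant of the law of the root, which is chosen with probability
proportional to the `(k - 1)`-st power of its degree `d`. -/
def rootWeight (d : Fin n → ℕ) (k : ℕ) : ℕ := ∑ v, d v ^ (k - 1)

lemma rootWeight_profile_le (hk : 2 ≤ k) :
    rootWeight (profile G k) k ≤ k ^ (2 * k) * (k * #(graphlets G k)) := by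
  have h_double : ∑ v, #{S ∈ graphlets G k | v ∈ S} = k * #(graphlets G k) := by
    simp only [Finset.card_filter]
    rw [Finset.sum_comm]
    simp only [Finset.sum_boole, Finset.filter_univ_mem, Nat.cast_id]
    rw [Finset.sum_congr rfl fun S hS => (mem_graphlets.1 hS).1, Finset.sum_const, smul_eq_mul,
      mul_comm]
  rw [← h_double, Finset.mul_sum]
  exact Finset.sum_le_sum fun v _ => profile_pow_le hk v

lemma rootWeight_profile_pos (hk : 2 ≤ k) (h : (graphlets G k).Nonempty) :
    0 < rootWeight (profile G k) k := by
  obtain ⟨S, hS⟩ := h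
  obtain ⟨v, hv⟩ : S.Nonempty := Finset.card_pos.1 (by rw [(mem_graphlets.1 hS).1]; omega)
  exact Finset.sum_pos' (fun _ _ => Nat.zero_le _) ⟨v, Finset.mem_univ _,
    pow_pos ((alive_of_mem_graphlets hS hv).profile_pos hk) _⟩

end Profile

/-! ### Growing a set of vertices edge by edge -/

lemma sum_sum_compl_eq_sum_sum_erase {V R : Type*} [Fintype V] [DecidableEq V]
    [AddCommMonoid R] (f : Finset V → V → R) :
    ∑ S, ∑ u ∈ Sᶜ, f S u = ∑ S, ∑ u ∈ S, f (S.erase u) u := by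
  rw [Finset.sum_sigma', Finset.sum_sigma']
  refine Finset.sum_nbij' (fun p => ⟨insert p.2 p.1, p.2⟩) (fun p => ⟨p.1.erase p.2, p.2⟩)
    ?_ ?_ ?_ ?_ ?_ <;> rintro ⟨S, u⟩ hu <;>
    simp only [Finset.mem_sigma, Finset.mem_univ, true_and, Finset.mem_compl] at hu
  · simp
  · simp
  · simp [Finset.erase_insert hu]
  · simp [Finset.insert_erase hu]
  · simp [Finset.erase_insert hu]

section Growth

variable {n : ℕ} {G H : SimpleGraph (Fin n)} {d : Fin n → ℕ} {i : ℕ} {S : Finset (Fin n)}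
  {K : Type*} [Semifield K]

/-- The number of neighbours of `u` in `S`. -/
def linkCount (G : SimpleGraph (Fin n)) (S : Finset (Fin n)) (u : Fin n) : ℕ := #{a ∈ S | G.Adj a u}

/-- The number of ways to obtain `S` from a single vertex with `d > 0` by adding `i` times the
outer end of an edge that leaves the present set, where `d` never exceeds the maximum of `d` on
this set. So the first vertex must be a maximum of `d` on `S`. -/
def growthCount (G : SimpleGraph (Fin n)) (d : Fin n → ℕ) : ℕ → Finset (Fin n) → ℕ
  | 0, S => if ∃ v, S = {v} ∧ 0 < d v then 1 else 0
  | i + 1, S => ∑ u ∈ S with d u ≤ (S.erase u).sup d,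
      growthCount G d i (S.erase u) * linkCount G (S.erase u) u

lemma growthCount_congr (h : ∀ a ∈ S, ∀ b ∈ S, G.Adj a b ↔ H.Adj a b) :
    growthCount G d i S = growthCount H d i S := by
  induction i generalizing S with
  | zero => rfl
  | succ i ih =>
    refine Finset.sum_congr rfl fun u hu => ?_
    have h_mem : ∀ a ∈ S.erase u, a ∈ S := fun a => Finset.mem_of_mem_erase
    rw [ih fun a ha b hb => h a (h_mem a ha) b (h_mem b hb), linkCount, linkCount,
      Finset.filter_congr fun a ha => h a (h_mem a ha) u (Finset.mem_filter.1 hu).1]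

lemma card_and_sup_pos_of_growthCount_ne_zero (h : growthCount G d i S ≠ 0) :
    #S = i + 1 ∧ 0 < S.sup d := by
  induction i generalizing S with
  | zero =>
    obtain ⟨v, rfl, hv⟩ : ∃ v, S = {v} ∧ 0 < d v := by
      simpa [growthCount, pos_iff_ne_zero] using h
    simp [hv]
  | succ i ih =>
    obtain ⟨u, hu, hu0⟩ := Finset.exists_ne_zero_of_sum_ne_zero h
    obtain ⟨h_card, h_sup⟩ := ih (left_ne_zero_of_mul hu0)
    have huS := (Finset.mem_filter.1 hu).1
    exact ⟨by rw [← Finset.card_erase_add_one huS, h_card],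
      h_sup.trans_le (Finset.sup_mono (Finset.erase_subset _ _))⟩

lemma growthCount_pos (hS : S ∈ graphlets G (i + 1)) (hd : ∀ v ∈ S, 0 < d v) :
    0 < growthCount G d i S := by
  obtain ⟨h_card, h_conn⟩ := mem_graphlets.1 hS
  obtain ⟨v, hv, hmax⟩ := Finset.exists_max_image S d (Finset.card_pos.1 (by omega))
  have h_grow : ∀ j ≤ i, ∃ T ⊆ S, v ∈ T ∧ 0 < growthCount G d j T := by
    intro j
    induction j with
    | zero => exact fun _ => ⟨{v}, by simpa using hv, by simp, by simp [growthCount, hd v hv]⟩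
    | succ j ih =>
      intro hj
      obtain ⟨T, hTS, hvT, hT⟩ := ih (by omega)
      have hT_card := (card_and_sup_pos_of_growthCount_ne_zero hT.ne').1
      obtain ⟨w, hwS, hwT⟩ := Finset.exists_mem_notMem_of_card_lt_card (s := T) (t := S) (by omega)
      obtain ⟨a, ha, b, hb : b.1 ∉ T, hab⟩ := exists_adj_of_reachable
        (T := {x : (S : Set (Fin n)) | x.1 ∈ T}) (h_conn.preconnected ⟨v, hv⟩ ⟨w, hwS⟩) hvT hwT
      refine ⟨insert b.1 T, Finset.insert_subset b.2 hTS, by simp [hvT],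
        Finset.sum_pos' (fun _ _ => Nat.zero_le _) ⟨b.1, ?_, ?_⟩⟩
      · simpa [Finset.erase_insert hb] using (hmax b.1 b.2).trans (Finset.le_sup hvT)
      · rw [Finset.erase_insert hb]
        exact mul_pos hT (Finset.card_pos.2 ⟨a.1, Finset.mem_filter.2 ⟨ha, hab⟩⟩)
  obtain ⟨T, hTS, -, hT⟩ := h_grow i le_rfl
  have hT_card := (card_and_sup_pos_of_growthCount_ne_zero hT.ne').1
  rwa [← Finset.eq_of_subset_of_card_le hTS (by omega)]

/-- The average of `g` after one growth step from `S`, where a step that fails counts as zero. One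
of `#S * S.sup d` equally likely slots is chosen, and each edge that leaves `S` for an admissible
vertex occupies one slot. -/
def growthStep (G : SimpleGraph (Fin n)) (d : Fin n → ℕ) (g : Finset (Fin n) → K)
    (S : Finset (Fin n)) : K :=
  (∑ u ∈ Sᶜ with d u ≤ S.sup d, linkCount G S u * g (insert u S)) / (#S * S.sup d : ℕ)

variable [CharZero K]

lemma growthCount_mul_growthStep (g : Finset (Fin n) → K) (i : ℕ) (S : Finset (Fin n)) :
    growthCount G d i S * (S.sup d : ℕ) * growthStep G d g S / i.factorial =
      ∑ u ∈ Sᶜ with d u ≤ S.sup d,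
        growthCount G d i S * linkCount G S u * g (insert u S) / (i + 1).factorial := by
  by_cases h0 : growthCount G d i S = 0
  · simp [h0]
  obtain ⟨h_card, h_sup⟩ := card_and_sup_pos_of_growthCount_ne_zero h0
  simp only [mul_assoc]
  rw [← Finset.sum_div, ← Finset.mul_sum, growthStep, h_card, Nat.factorial_succ]
  have h_sup' : ((S.sup d : ℕ) : K) ≠ 0 := by exact_mod_cast h_sup.ne'
  have h_fact : (i.factorial : K) ≠ 0 := by exact_mod_cast i.factorial_ne_zero
  push_cast
  field_simp

/-- The powers of the maximum of `d` telescope: a growth step keeps the maximum and divides by it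
once. -/
lemma sum_growthCount_mul_growthStep (G : SimpleGraph (Fin n)) (d : Fin n → ℕ)
    (g : Finset (Fin n) → K) (i m : ℕ) :
    ∑ S, growthCount G d i S * (S.sup d : ℕ) ^ (m + 1) * growthStep G d g S / i.factorial =
      ∑ S, growthCount G d (i + 1) S * (S.sup d : ℕ) ^ m * g S / (i + 1).factorial := by
  let f (S : Finset (Fin n)) (u : Fin n) : K :=
    if d u ≤ S.sup d then (S.sup d : ℕ) ^ m * (growthCount G d i S * linkCount G S u *
      g (insert u S) / (i + 1).factorial) else 0
  have h_left : ∀ S, growthCount G d i S * ((S.sup d : ℕ) : K) ^ (m + 1) * growthStep G d g S /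
      i.factorial = ∑ u ∈ Sᶜ, f S u := by
    intro S
    rw [← Finset.sum_filter, ← Finset.mul_sum, ← growthCount_mul_growthStep]
    ring
  have h_right : ∀ S, growthCount G d (i + 1) S * ((S.sup d : ℕ) : K) ^ m * g S /
      (i + 1).factorial = ∑ u ∈ S, f (S.erase u) u := by
    intro S
    rw [growthCount, ← Finset.sum_filter_add_sum_filter_not S (fun u => d u ≤ (S.erase u).sup d)
      (fun u => f _ u), Finset.sum_eq_zero (s := {u ∈ S | ¬ _}) fun u hu =>
        if_neg (Finset.mem_filter.1 hu).2, add_zero]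
    push_cast
    rw [Finset.sum_mul, Finset.sum_mul, Finset.sum_div]
    refine Finset.sum_congr rfl fun u hu => ?_
    obtain ⟨huS, hdu⟩ := Finset.mem_filter.1 hu
    have h_sup : S.sup d = (S.erase u).sup d := by
      conv_lhs => rw [← Finset.insert_erase huS, Finset.sup_insert]
      exact sup_eq_right.2 hdu
    simp only [f, if_pos hdu, h_sup, Finset.insert_erase huS]
    ring
  rw [Finset.sum_congr rfl fun S _ => h_left S, Finset.sum_congr rfl fun S _ => h_right S,
    sum_sum_compl_eq_sum_sum_erase]

lemma sum_growthCount_mul_iterate (G : SimpleGraph (Fin n)) (d : Fin n → ℕ)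
    (g : Finset (Fin n) → K) (i j : ℕ) :
    ∑ S, growthCount G d i S * (S.sup d : ℕ) ^ j * ((growthStep G d)^[j] g) S / i.factorial =
      ∑ S, growthCount G d (i + j) S * g S / (i + j).factorial := by
  induction j generalizing i with
  | zero => simp
  | succ j ih =>
    simp only [Function.iterate_succ_apply']
    rw [sum_growthCount_mul_growthStep, ih (i + 1), Nat.add_right_comm, add_assoc]

/-- A root chosen with probability proportional to `d ^ j`, followed by `j` growth steps, produces
each set `S` with probability proportional to `growthCount G d j S`. -/
lemma sum_pow_mul_iterate (G : SimpleGraph (Fin n)) (d : Fin n → ℕ)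
    (g : Finset (Fin n) → K) {j : ℕ} (hj : j ≠ 0) :
    ∑ v, (d v : K) ^ j * ((growthStep G d)^[j] g) {v} =
      ∑ S, growthCount G d j S * g S / j.factorial := by
  have h_iterate := sum_growthCount_mul_iterate G d g 0 j
  rw [zero_add] at h_iterate
  rw [← h_iterate]
  have h_singleton : ∀ S : Finset (Fin n), (growthCount G d 0 S * ((S.sup d : ℕ) : K) ^ j *
      ((growthStep G d)^[j] g) S / (Nat.factorial 0 : K)) =
      ∑ v, if S = {v} then (d v : K) ^ j * ((growthStep G d)^[j] g) {v} else 0 := by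
    intro S
    by_cases hS : ∃ v, S = {v}
    · obtain ⟨v, rfl⟩ := hS
      by_cases hv : 0 < d v
      · simp [growthCount, hv]
      · simp [Nat.eq_zero_of_not_pos hv, hj]
    · push Not at hS
      simp [growthCount, hS]
  rw [Finset.sum_congr rfl fun S _ => h_singleton S, Finset.sum_comm]
  simp

end Growth

/-! ### Preprocessing: degrees and components in one pass -/

section Preprocessing

variable {n k : ℕ} {G : SimpleGraph (Fin n)} {l : List (Sym2 (Fin n))}

lemma lt_two_pow_wordSize {m : ℕ} (h : m ≤ n) : m < 2 ^ wordSize n :=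
  h.trans_lt (Nat.lt_pow_succ_log_self (by norm_num) n)

lemma Fits.forall_le (n : ℕ) : Fits {d : Fin n → ℕ | ∀ v, d v ≤ n} (n * wordSize n) := by
  have h_lt : Fits {i | i < n + 1} (wordSize n) := Fits.nat_lt (lt_two_pow_wordSize le_rfl)
  simpa [Nat.lt_succ_iff] using h_lt.pi (ι := Fin n)

lemma Fits.setoid (n : ℕ) : Fits (Set.univ : Set (Setoid (Fin n))) (n * wordSize n) := by
  refine ((Fits.forall_le n).image Setoid.ker).mono (fun r _ =>
    ⟨fun v => (Quotient.out (Quotient.mk r v)).1, fun v => (Fin.is_lt _).le,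
      Setoid.ext fun a b => ?_⟩) le_rfl
  rw [Setoid.ker_def, ← Fin.ext_iff, Quotient.out_inj]
  exact Quotient.eq

lemma IsEdgeStream.countP_eq_degree (h : IsEdgeStream G l) (v : Fin n) :
    l.countP (v ∈ ·) = G.degree v := by
  rw [List.countP_eq_length_filter, ← List.toFinset_card_of_nodup (h.1.filter _),
    ← G.card_incidenceFinset_eq_degree]
  congr 1
  ext e
  simp [SimpleGraph.mem_incidenceFinset, SimpleGraph.incidenceSet, h.2]

/-- The state of the preprocessing: the degrees and the components of the graph read so far, and
in the end the degree profile. -/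
abbrev PreState (n : ℕ) : Type := ((Fin n → ℕ) × Setoid (Fin n)) ⊕ (Fin n → ℕ)

/-- The degrees and the components of the graph with the edge list `l`. The degrees are capped at
`n`, so that the number of states is bounded for every list. -/
def PreState.ofList (l : List (Sym2 (Fin n))) : PreState n :=
  .inl (fun v => min (l.countP (v ∈ ·)) n, Relation.EqvGen.setoid fun a b => s(a, b) ∈ l)

/-- The update of the degrees and the components when an edge is read. -/
def PreState.read : PreState n → Sym2 (Fin n) → PreState n
  | .inl (c, r), e => .inl (fun v => min (c v + if v ∈ e then 1 else 0) n,
      r ⊔ Relation.EqvGen.setoid fun a b => s(a, b) = e)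
  | .inr d, _ => .inr d

/-- The computation of the degree profile at the end of the pass. -/
def PreState.finish (k : ℕ) : PreState n → PreState n
  | .inl (c, r) => .inr fun v => if k ≤ #{u | r v u} then c v else 0
  | .inr d => .inr d

/-- The machine that computes the degree profile in one pass. -/
def preMachine (n k : ℕ) : Machine n (PreState n) where
  step x e := PMF.pure (x.read e)
  endPass x := PMF.pure (x.finish k)
  left := Sum.elim (fun _ => 1) fun _ => 0

/-- The states of the preprocessing in which all numbers are at most `n`. -/
def preStates (n : ℕ) : Set (PreState n) :=
  {s | Sum.elim (· ∈ {d : Fin n → ℕ | ∀ v, d v ≤ n} ×ˢ Set.univ)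
    (· ∈ {d : Fin n → ℕ | ∀ v, d v ≤ n}) s}

lemma preStates_fits (n : ℕ) : Fits (preStates n) (3 * (n * wordSize n) + 1) :=
  (((Fits.forall_le n).prod (Fits.setoid n)).sum (Fits.forall_le n)).mono subset_rfl (by omega)

lemma preMachine_closed (n k : ℕ) : (preMachine n k).Closed (preStates n) := by
  constructor
  · rintro (⟨c, r⟩ | d) hx e y hy <;> obtain rfl := (PMF.mem_support_pure_iff _ _).1 hy
    · exact ⟨fun v => min_le_right _ _, Set.mem_univ _⟩
    · exact hx
  · rintro (⟨c, r⟩ | d) hx y hy <;> obtain rfl := (PMF.mem_support_pure_iff _ _).1 hy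
    · intro v
      change (if _ then c v else 0) ≤ n
      split_ifs
      · exact hx.1 v
      · exact Nat.zero_le _
    · exact hx

lemma PreState.read_ofList (l : List (Sym2 (Fin n))) (e : Sym2 (Fin n)) :
    (ofList l).read e = ofList (l ++ [e]) := by
  refine congrArg Sum.inl (Prod.ext (funext fun v => ?_) ?_)
  · have h_count : (l ++ [e]).countP (v ∈ ·) = l.countP (v ∈ ·) + if v ∈ e then 1 else 0 := by
      simp [List.countP_append]
    simp only [h_count]
    omega
  · simp only [List.mem_append, List.mem_singleton]
    exact (Setoid.gi.gc.l_sup (a₁ := fun a b => s(a, b) ∈ l)).symm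

lemma PreState.foldl_read (l : List (Sym2 (Fin n))) :
    l.foldl PreState.read (ofList []) = ofList l := by
  induction l using List.reverseRecOn with
  | nil => rfl
  | append_singleton l e ih => rw [List.foldl_concat, ih, read_ofList]

lemma IsEdgeStream.eqvGen_setoid (h : IsEdgeStream G l) :
    (Relation.EqvGen.setoid fun a b => s(a, b) ∈ l) = G.reachableSetoid := by
  refine le_antisymm (Setoid.eqvGen_le fun a b hab => SimpleGraph.Adj.reachable ((h.2 _).1 hab)) ?_
  rintro a b ⟨p⟩
  induction p with
  | nil => exact Setoid.refl' _ _
  | cons hadj _ ih => exact Setoid.trans' _ (Relation.EqvGen.rel _ _ ((h.2 _).2 hadj)) ih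

lemma preMachine_pass (h : IsEdgeStream G l) :
    (preMachine n k).pass l (PreState.ofList []) = PMF.pure (.inr (profile G k)) := by
  rw [Machine.pass, drawFold_eq_pure_foldl (f := (preMachine n k).step) (upd := PreState.read)
    fun _ _ => rfl, PMF.pure_bind, PreState.foldl_read]
  refine congrArg PMF.pure (congrArg Sum.inr (funext fun v => ?_))
  have h_degree : min (G.degree v) n = G.degree v :=
    min_eq_left ((G.degree_lt_card_verts v).le.trans (by simp))
  have h_reach (u : Fin n) :
      (Relation.EqvGen.setoid fun a b => s(a, b) ∈ l) v u ↔ G.Reachable v u := by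
    rw [h.eqvGen_setoid]
    rfl
  simp only [h.countP_eq_degree, h_degree, h_reach, profile, Alive]
  congr

lemma preMachine_isInvariant (G : SimpleGraph (Fin n)) (k : ℕ) :
    (preMachine n k).IsInvariant G fun x =>
      x = PreState.ofList [] ∨ x = .inr (profile G k) := by
  rintro x (rfl | rfl) hx l hl y hy
  · rw [preMachine_pass hl, PMF.support_pure, Set.mem_singleton_iff] at hy
    subst hy
    exact ⟨Or.inr rfl, rfl⟩
  · exact absurd rfl hx

lemma exists_preprocessing (n k : ℕ) :
    ∃ (A : Phase n) (K : Coding {d : Fin n → ℕ | ∀ v, d v ≤ n} (3 * (n * wordSize n) + 1)),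
      ∀ (G : SimpleGraph (Fin n)) (order : Config → List (Sym2 (Fin n))),
        (∀ s, IsEdgeStream G (order s)) → ∀ N, 1 ≤ N → ∀ t ∈ (A.run order N []).support,
          A.halt t.mem = true ∧ t = ⟨K.enc (profile G k), 1, 3 * (n * wordSize n) + 1⟩ := by
  obtain ⟨K⟩ := (preStates_fits n).nonempty_coding
  have h_start : PreState.ofList [] ∈ preStates n := ⟨fun v => min_le_right _ _, Set.mem_univ _⟩
  refine ⟨(preMachine n k).toPhase K fun _ => PMF.pure (PreState.ofList []),
    ⟨fun d => K.enc (.inr d), fun m => Sum.elim (fun _ => 0) id (K.dec m), fun d hd => ?_,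
      fun d => K.length_enc _⟩, fun G order horder N hN t ht => ?_⟩
  · rw [K.dec_enc (.inr d) hd, Sum.elim_inr, id]
  · obtain ⟨y, hy, hPy, hy0, rfl⟩ := Machine.mem_support_run_toPhase (preMachine_closed n k)
      (preMachine_isInvariant G k) horder (Q := 1) (by simpa using ⟨h_start, rfl⟩) hN ht
    refine ⟨(Machine.halt_toPhase hy).2 hy0, ?_⟩
    rcases hPy with rfl | rfl
    · exact absurd hy0 one_ne_zero
    · simp

end Preprocessing

/-! ### Exact counting with few watched sets -/

section ExactCounting

variable {n k : ℕ}

/-- The empirical distribution of a vector of counters. If all counters are zero, it is the point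
mass at an arbitrary class. -/
def estimate [Nonempty (GraphletClass k)] (c : GraphletClass k → ℕ) : GraphletClass k → ℝ :=
  if ∑ j, c j = 0 then Pi.single (Classical.arbitrary _) 1 else fun i => c i / (∑ j, c j : ℕ)

lemma estimate_mem_stdSimplex [Nonempty (GraphletClass k)] (c : GraphletClass k → ℕ) :
    estimate c ∈ stdSimplex ℝ (GraphletClass k) := by
  rw [estimate]
  split_ifs with h
  · exact single_mem_stdSimplex ℝ _
  · refine ⟨fun i => by positivity, ?_⟩
    rw [← Finset.sum_div, Nat.cast_sum, div_self]
    exact_mod_cast h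

lemma estimate_graphletCount [Nonempty (GraphletClass k)] {G : SimpleGraph (Fin n)}
    (h : 0 < numGraphlets k G) : estimate (graphletCount G) = graphletDist (k := k) G := by
  exact if_neg h.ne'

lemma nonempty_graphletClass (hk : 0 < k) : Nonempty (GraphletClass k) :=
  ⟨Quotient.mk (graphletSetoid k) ⟨splitGraph k 0, splitGraph_connected hk 0⟩⟩

/-- There is a sampling phase that, started with the degree profile in memory, makes at most `B`
passes, uses at most `M` words and returns an `α`-approximation of the graphlet distribution with
probability at least `1 - δ`. -/
def HasSampler (n k M : ℕ) (α δ B : ℝ) (write : (Fin n → ℕ) → Memory) : Prop :=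
  ∃ (A : Phase n) (out : Memory → GraphletClass k → ℝ) (N₀ : ℕ), ∀ N, N₀ ≤ N →
    ∀ (G : SimpleGraph (Fin n)) (order : Config → List (Sym2 (Fin n))),
      (∀ s, IsEdgeStream G (order s)) →
      (∀ t ∈ (A.run order N (write (profile G k))).support,
        A.halt t.mem = true ∧ out t.mem ∈ stdSimplex ℝ (GraphletClass k) ∧ (t.passes : ℝ) ≤ B ∧
          t.peak ≤ M * wordSize n) ∧
      (0 < numGraphlets k G →
        ENNReal.ofReal (1 - δ) ≤ (A.run order N (write (profile G k))).toOuterMeasure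
          {t | ∀ i : GraphletClass k, |out t.mem i - graphletDist G i| ≤ α})

lemma Fits.subset_sym2 {κ : ℕ} {W : Finset (Fin n)} (hW : #W ≤ κ) :
    Fits {E : Finset (Sym2 (Fin n)) | E ⊆ W.sym2} (κ * κ) := by
  refine (Fits.finset (A := W.sym2.powerset) ?_).mono
    (fun E hE => Finset.mem_coe.2 (Finset.mem_powerset.2 hE)) le_rfl
  rw [Finset.card_powerset, Finset.card_sym2, Nat.choose_two_right, Nat.add_sub_cancel]
  refine pow_le_pow_right₀ one_le_two (Nat.div_le_of_le_mul ?_)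
  nlinarith [Nat.le_mul_self #W, Nat.mul_le_mul hW hW]

/-- Record an edge if its ends belong to the watched set `W`. -/
def recordEdge (W : Finset (Fin n)) (E : Finset (Sym2 (Fin n))) (e : Sym2 (Fin n)) :
    Finset (Sym2 (Fin n)) :=
  if e ∈ W.sym2 then insert e E else E

lemma recordEdge_subset {W : Finset (Fin n)} {E : Finset (Sym2 (Fin n))} (h : E ⊆ W.sym2)
    (e : Sym2 (Fin n)) : recordEdge W E e ⊆ W.sym2 := by
  unfold recordEdge
  split_ifs with he
  · exact Finset.insert_subset he h
  · exact h

lemma mem_foldl_recordEdge {W : Finset (Fin n)} {l : List (Sym2 (Fin n))}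
    {E : Finset (Sym2 (Fin n))} {e : Sym2 (Fin n)} :
    e ∈ l.foldl (recordEdge W) E ↔ e ∈ E ∨ e ∈ l ∧ e ∈ W.sym2 := by
  induction l generalizing E with
  | nil => simp
  | cons f l ih =>
    rw [List.foldl_cons, ih, recordEdge, List.mem_cons]
    split_ifs with hf
    · rw [Finset.mem_insert]
      grind
    · grind

lemma IsEdgeStream.adj_recorded_iff {G : SimpleGraph (Fin n)} {l : List (Sym2 (Fin n))}
    (hl : IsEdgeStream G l) {W : Finset (Fin n)} {a b : Fin n} (ha : a ∈ W) (hb : b ∈ W) :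
    (SimpleGraph.fromEdgeSet ((l.foldl (recordEdge W) ∅ : Finset _) : Set (Sym2 (Fin n)))).Adj a b ↔
      G.Adj a b := by
  rw [SimpleGraph.fromEdgeSet_adj, Finset.mem_coe, mem_foldl_recordEdge, hl.2,
    Finset.mk_mem_sym2_iff, SimpleGraph.mem_edgeSet]
  simp only [Finset.notMem_empty, false_or, ha, hb, and_true]
  exact ⟨fun h => h.1, fun h => ⟨h, h.ne⟩⟩

lemma pow_lt_two_pow (n : ℕ) (hk : 0 < k) : n ^ k < 2 ^ (k * wordSize n) := by
  rw [mul_comm, pow_mul]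
  exact Nat.pow_lt_pow_left (lt_two_pow_wordSize le_rfl) hk.ne'

/-- The number of passes that are left, the counters of the classes, and the recorded edges. -/
abbrev ExactState (n k : ℕ) : Type := (ℕ × (GraphletClass k → ℕ)) × Finset (Sym2 (Fin n))

/-- The machine that counts graphlets exactly. During the pass that leaves `r` further passes it
records the edges inside `ws r`, and then it counts the graphlets `S` with `idx S = r`. -/
def exactMachine (k : ℕ) (ws : ℕ → Finset (Fin n)) (idx : Finset (Fin n) → ℕ) :
    Machine n (ExactState n k) where
  step x e := PMF.pure (x.1, recordEdge (ws (x.1.1 - 1)) x.2 e)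
  endPass x := PMF.pure (if x.1.1 = 0 then x else
    ((x.1.1 - 1, fun i => x.1.2 i + #{S ∈ Finset.powersetCard k Finset.univ |
      classOf k (SimpleGraph.fromEdgeSet (x.2 : Set (Sym2 (Fin n)))) S = some i ∧
        idx S = x.1.1 - 1}), ∅))
  left x := x.1.1

/-- The states of the exact counting within the first `Q` passes. -/
def exactStates (k : ℕ) (ws : ℕ → Finset (Fin n)) (idx : Finset (Fin n) → ℕ) (Q : ℕ) :
    Set (ExactState n k) :=
  {x | (x.1.1 ≤ Q ∧
      ∀ i, x.1.2 i ≤ #{S ∈ Finset.powersetCard k Finset.univ | x.1.1 ≤ idx S}) ∧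
    x.2 ⊆ (ws (x.1.1 - 1)).sym2}

variable {ws : ℕ → Finset (Fin n)} {idx : Finset (Fin n) → ℕ} {κ Q : ℕ}

lemma exactStates_fits (hk : 0 < k) (hκ : ∀ j, #(ws j) ≤ κ) (hQ : Q ≤ n ^ k) :
    Fits (exactStates k ws idx Q) (k * wordSize n +
      Fintype.card (GraphletClass k) * (k * wordSize n) + κ * κ) := by
  have h_le : Fits {i | i < n ^ k + 1} (k * wordSize n) :=
    Fits.nat_lt (Nat.succ_le_of_lt (pow_lt_two_pow n hk))
  have h_counters := h_le.prod (h_le.pi (ι := GraphletClass k))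
  have h_edges (y : ℕ × (GraphletClass k → ℕ)) :
      Fits {E : Finset (Sym2 (Fin n)) | E ⊆ (ws (y.1 - 1)).sym2} (κ * κ) :=
    Fits.subset_sym2 (hκ _)
  have h_all := h_counters.sigma fun y _ => h_edges y
  refine h_all.mono ?_ le_rfl
  rintro ⟨⟨r, c⟩, E⟩ ⟨⟨hr, hc⟩, hE⟩
  refine ⟨⟨Nat.lt_succ_of_le (hr.trans hQ), fun i => Nat.lt_succ_of_le ?_⟩, hE⟩
  calc c i ≤ #(Finset.powersetCard k (Finset.univ : Finset (Fin n))) :=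
        (hc i).trans (Finset.card_filter_le _ _)
    _ ≤ n ^ k := by simpa using Nat.choose_le_pow n k

lemma exactMachine_closed : (exactMachine k ws idx).Closed (exactStates k ws idx Q) := by
  constructor
  · rintro x ⟨hx, hE⟩ e y hy
    obtain rfl := (PMF.mem_support_pure_iff _ _).1 hy
    exact ⟨hx, recordEdge_subset hE e⟩
  · rintro ⟨⟨_ | r, c⟩, E⟩ ⟨⟨hr, hc⟩, hE⟩ y hy <;>
      obtain rfl := (PMF.mem_support_pure_iff _ _).1 hy
    · exact ⟨⟨hr, hc⟩, hE⟩
    · refine ⟨⟨(Nat.le_succ r).trans hr, fun i => ?_⟩, Finset.empty_subset _⟩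
      calc _ ≤ #{S ∈ Finset.powersetCard k Finset.univ | r + 1 ≤ idx S} +
            #{S ∈ Finset.powersetCard k Finset.univ | idx S = r} :=
            add_le_add (hc i)
              (Finset.card_le_card (Finset.monotone_filter_right _ fun S _ hS => hS.2))
        _ = #{S ∈ Finset.powersetCard k Finset.univ | r ≤ idx S} := by
          rw [← Finset.card_union_of_disjoint (Finset.disjoint_filter.2 fun S _ => by grind),
            ← Finset.filter_or]
          exact congrArg Finset.card (Finset.filter_congr fun S _ => by grind)

/-- The state before the pass that leaves `r - 1` further passes. -/
def exactState (G : SimpleGraph (Fin n)) (idx : Finset (Fin n) → ℕ) (r : ℕ) : ExactState n k :=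
  ((r, fun i => #{S ∈ Finset.powersetCard k Finset.univ | classOf k G S = some i ∧ r ≤ idx S}), ∅)

variable {G : SimpleGraph (Fin n)}

lemma exactState_of_lt (hidx : ∀ S, #S = k → idx S < Q) :
    exactState (k := k) G idx Q = ((Q, 0), ∅) := by
  refine Prod.ext (Prod.ext rfl (funext fun i => ?_)) rfl
  change #{S ∈ Finset.powersetCard k Finset.univ | classOf k G S = some i ∧ Q ≤ idx S} = 0
  refine Finset.card_eq_zero.2 (Finset.filter_eq_empty_iff.2 fun S hS h => ?_)
  exact h.2.not_gt (hidx S (Finset.mem_powersetCard.1 hS).2)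

lemma exactState_zero : exactState (k := k) G idx 0 = ((0, graphletCount G), ∅) := by
  refine Prod.ext (Prod.ext rfl (funext fun i => ?_)) rfl
  simp only [exactState, graphletCount_eq_card, Nat.zero_le, and_true]
  congr 1
  ext S
  simp only [Finset.mem_filter, Finset.mem_powersetCard_univ, and_congr_left_iff]
  intro h
  have h_mem := exists_classOf_eq_some_iff.1 ⟨i, h⟩
  exact iff_of_true (mem_graphlets.1 h_mem).1 h_mem

lemma exactMachine_pass {l : List (Sym2 (Fin n))} (hl : IsEdgeStream G l)
    (hidx : ∀ S, #S = k → S ⊆ ws (idx S)) (r : ℕ) :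
    (exactMachine k ws idx).pass l (exactState G idx (r + 1)) = PMF.pure (exactState G idx r) := by
  have h_fold : l.foldl (fun x e => (x.1, recordEdge (ws (x.1.1 - 1)) x.2 e))
      (exactState (k := k) G idx (r + 1)) =
        ((exactState G idx (r + 1)).1, l.foldl (recordEdge (ws r)) ∅) :=
    List.foldl_hom (Prod.mk _) fun _ _ => rfl
  rw [Machine.pass, drawFold_eq_pure_foldl (f := (exactMachine k ws idx).step)
    (upd := fun x e => (x.1, recordEdge (ws (x.1.1 - 1)) x.2 e)) fun _ _ => rfl,
    PMF.pure_bind, h_fold]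
  have h_new (i : GraphletClass k) : #{S ∈ Finset.powersetCard k Finset.univ |
        classOf k (SimpleGraph.fromEdgeSet
          ((l.foldl (recordEdge (ws r)) ∅ : Finset _) : Set (Sym2 (Fin n)))) S = some i ∧
        idx S = r} =
      #{S ∈ Finset.powersetCard k Finset.univ | classOf k G S = some i ∧ idx S = r} := by
    refine congrArg Finset.card (Finset.filter_congr fun S hS => and_congr_left ?_)
    rintro rfl
    have h_sub := hidx S (Finset.mem_powersetCard.1 hS).2
    rw [classOf_congr fun a ha b hb => hl.adj_recorded_iff (h_sub ha) (h_sub hb)]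
  have h_count (i : GraphletClass k) :
      #{S ∈ Finset.powersetCard k Finset.univ | classOf k G S = some i ∧ r + 1 ≤ idx S} +
        #{S ∈ Finset.powersetCard k Finset.univ | classOf k G S = some i ∧ idx S = r} =
      #{S ∈ Finset.powersetCard k Finset.univ | classOf k G S = some i ∧ r ≤ idx S} := by
    rw [← Finset.card_union_of_disjoint (Finset.disjoint_filter.2 fun S _ => by grind),
      ← Finset.filter_or]
    exact congrArg Finset.card (Finset.filter_congr fun S _ => by grind)
  exact congrArg PMF.pure (Prod.ext
    (Prod.ext rfl (funext fun i => (congrArg _ (h_new i)).trans (h_count i))) rfl)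

lemma exactMachine_isInvariant (G : SimpleGraph (Fin n)) (hidx : ∀ S, #S = k → S ⊆ ws (idx S)) :
    (exactMachine k ws idx).IsInvariant G fun x => ∃ r, x = exactState G idx r := by
  rintro x ⟨_ | r, rfl⟩ hx l hl y hy
  · exact absurd rfl hx
  · rw [exactMachine_pass hl hidx, PMF.mem_support_pure_iff] at hy
    subst hy
    exact ⟨⟨r, rfl⟩, rfl⟩

lemma hasSampler_of_cover {M : ℕ} {α δ B : ℝ} (hk : 0 < k) (hα : 0 ≤ α) (hδ : 0 ≤ δ)
    (hκ : ∀ j, #(ws j) ≤ κ) (hQ : Q ≤ n ^ k)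
    (hcov : ∀ S : Finset (Fin n), #S = k → ∃ j < Q, S ⊆ ws j) (hB : (Q : ℝ) ≤ B)
    (hM : k * wordSize n + Fintype.card (GraphletClass k) * (k * wordSize n) + κ * κ ≤
      M * wordSize n)
    {write : (Fin n → ℕ) → Memory} (hwrite : ∀ d, (write d).length ≤ M * wordSize n) :
    HasSampler n k M α δ B write := by
  have := nonempty_graphletClass hk
  choose! idx hidx_lt hidx using hcov
  obtain ⟨K⟩ := (exactStates_fits (idx := idx) hk hκ hQ).nonempty_coding
  set A := (exactMachine k ws idx).toPhase K fun _ => PMF.pure ((Q, 0), ∅)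
  refine ⟨A, fun m => estimate (K.dec m).1.2, Q, fun N hN G order horder => ?_⟩
  have h_run : ∀ t ∈ (A.run order N (write (profile G k))).support,
      A.halt t.mem = true ∧ K.dec t.mem = ((0, graphletCount G), ∅) ∧ t.passes = Q ∧
        t.peak ≤ M * wordSize n := by
    intro t ht
    obtain ⟨y, hy, ⟨r, rfl⟩, hr, rfl⟩ := Machine.mem_support_run_toPhase (Q := Q)
      exactMachine_closed (exactMachine_isInvariant G hidx) horder (by
        rw [PMF.support_pure]
        rintro x rfl
        exact ⟨⟨⟨le_rfl, fun _ => Nat.zero_le _⟩, Finset.empty_subset _⟩,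
          ⟨Q, (exactState_of_lt hidx_lt).symm⟩, rfl⟩) hN ht
    obtain rfl : r = 0 := hr
    exact ⟨(Machine.halt_toPhase hy).2 rfl, (K.dec_enc _ hy).trans exactState_zero, rfl,
      max_le (hwrite _) hM⟩
  refine ⟨fun t ht => ?_, fun hG => ?_⟩
  · obtain ⟨h_halt, -, rfl, h_peak⟩ := h_run t ht
    exact ⟨h_halt, estimate_mem_stdSimplex _, hB, h_peak⟩
  · refine (ENNReal.ofReal_le_one.2 (by linarith)).trans_eq
      ((PMF.toOuterMeasure_apply_eq_one_iff _ _).2 fun t ht i => ?_).symm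
    simp only [(h_run t ht).2.1, estimate_graphletCount hG, sub_self, abs_zero, hα]

end ExactCounting

/-! ### Random choices -/

section Choices

/-- A uniformly random natural number below `r`, or `0` if `r = 0`. -/
def uniformBelow (r : ℕ) : PMF ℕ :=
  if h : r = 0 then PMF.pure 0 else PMF.uniformOfFinset (Finset.range r) (by simpa using h)

lemma mul_expect_uniformBelow (r : ℕ) (f : ℕ → ℝ≥0∞) :
    r * expect (uniformBelow r) f = ∑ t ∈ Finset.range r, f t := by
  rcases Nat.eq_zero_or_pos r with rfl | hr
  · simp
  rw [expect, tsum_eq_sum (s := Finset.range r), Finset.mul_sum]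
  · refine Finset.sum_congr rfl fun t ht => ?_
    rw [uniformBelow, dif_neg hr.ne', PMF.uniformOfFinset_apply_of_mem _ ht, Finset.card_range,
      ← mul_assoc, ENNReal.mul_inv_cancel (by exact_mod_cast hr.ne') (ENNReal.natCast_ne_top r),
      one_mul]
  · intro t ht
    rw [uniformBelow, dif_neg hr.ne', PMF.uniformOfFinset_apply_of_notMem _ ht, zero_mul]

/-- A random root, chosen with probability proportional to `d v ^ (k - 1)`; there is none if all
these weights vanish. -/
def rootLaw {n : ℕ} (d : Fin n → ℕ) (k : ℕ) : PMF (Finset (Fin n)) :=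
  if h : rootWeight d k = 0 then PMF.pure ∅
  else (PMF.normalize (fun v => ((d v ^ (k - 1) : ℕ) : ℝ≥0∞))
    (by rw [tsum_fintype, ← Nat.cast_sum]; exact_mod_cast h)
    (by rw [tsum_fintype, ← Nat.cast_sum]; exact ENNReal.natCast_ne_top _)).map fun v => {v}

variable {n k : ℕ} {d : Fin n → ℕ}

lemma mem_support_rootLaw (hk : 2 ≤ k) {S : Finset (Fin n)} (hS : S ∈ (rootLaw d k).support) :
    S = ∅ ∨ ∃ v, S = {v} ∧ 0 < d v := by
  unfold rootLaw at hS
  split_ifs at hS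
  · exact Or.inl (by simpa using hS)
  · obtain ⟨v, hv, rfl⟩ := (PMF.mem_support_map_iff _ _ _).1 hS
    have hv_ne := (PMF.mem_support_normalize_iff _ _ _).1 hv
    refine Or.inr ⟨v, rfl, Nat.pos_of_ne_zero fun h0 => hv_ne ?_⟩
    simp [h0, show k - 1 ≠ 0 by omega]

lemma rootWeight_mul_expect_rootLaw (d : Fin n → ℕ) (k : ℕ) (f : Finset (Fin n) → ℝ≥0∞) :
    rootWeight d k * expect (rootLaw d k) f = ∑ v, (d v : ℝ≥0∞) ^ (k - 1) * f {v} := by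
  by_cases h : rootWeight d k = 0
  · have h_zero := Finset.sum_eq_zero_iff.1 h
    rw [h, Nat.cast_zero, zero_mul, Finset.sum_eq_zero fun v hv => ?_]
    rw [← Nat.cast_pow, h_zero v hv, Nat.cast_zero, zero_mul]
  · have h_tsum : ∑' v, ((d v ^ (k - 1) : ℕ) : ℝ≥0∞) = rootWeight d k := by
      rw [tsum_fintype, ← Nat.cast_sum, rootWeight]
    rw [rootLaw, dif_neg h, expect_map, expect_fintype, Finset.mul_sum]
    refine Finset.sum_congr rfl fun v _ => ?_
    rw [PMF.normalize_apply, h_tsum, ← mul_assoc, mul_left_comm, ENNReal.mul_inv_cancel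
      (by exact_mod_cast h) (ENNReal.natCast_ne_top _), mul_one, Nat.cast_pow]

end Choices

/-! ### Reservoir sampling -/

section Reservoir

variable {V : Type*} {cap : ℕ}

/-- A step of reservoir sampling: the state is the number of items seen and a uniformly random one
of them. Only the first `cap` items count. The adversary orders a pass knowing the memory, so which
item is going to be chosen must not be fixed before the pass. -/
def reservoirStep (cap : ℕ) (x : ℕ × Option V) (v : V) : PMF (ℕ × Option V) :=
  if x.1 < cap then
    (uniformBelow (x.1 + 1)).map fun t => (x.1 + 1, if t = 0 then some v else x.2)
  else PMF.pure x

lemma mul_expect_reservoir (f : Option V → ℝ≥0∞) {vs : List V} {c : ℕ} (h : c + vs.length ≤ cap)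
    (u : Option V) :
    (c + vs.length : ℕ) * expect (drawFold (reservoirStep cap) vs (c, u)) (fun y => f y.2) =
      c * f u + (vs.map fun v => f (some v)).sum := by
  induction vs generalizing c u with
  | nil => simp [drawFold, expect_pure]
  | cons v vs ih =>
    rw [List.length_cons] at h ⊢
    have h_lt : c < cap := by omega
    simp only [drawFold, reservoirStep, h_lt, if_true, expect_bind, expect_map]
    rw [← expect_const_mul]
    have h_tail (t : ℕ) := ih (c := c + 1) (by omega) (if t = 0 then some v else u)
    rw [show c + 1 + vs.length = c + (vs.length + 1) by omega] at h_tail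
    calc _ = expect (uniformBelow (c + 1)) (fun t =>
            (c + 1 : ℕ) * f (if t = 0 then some v else u) + (vs.map fun v => f (some v)).sum) :=
          expect_congr _ fun t _ => h_tail t
      _ = ∑ t ∈ Finset.range (c + 1), f (if t = 0 then some v else u) +
            (vs.map fun v => f (some v)).sum := by
          rw [expect_add, expect_const, expect_const_mul, mul_expect_uniformBelow]
      _ = c * f u + ((v :: vs).map fun v => f (some v)).sum := by
          rw [Finset.sum_range_succ']
          simp [add_assoc]

lemma fst_of_mem_support_reservoir {vs : List V} {c : ℕ} (h : c + vs.length ≤ cap) (u : Option V)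
    {y : ℕ × Option V} (hy : y ∈ (drawFold (reservoirStep cap) vs (c, u)).support) :
    y.1 = c + vs.length := by
  induction vs generalizing c u with
  | nil => simp_all [drawFold]
  | cons v vs ih =>
    rw [List.length_cons] at h ⊢
    have h_lt : c < cap := by omega
    simp only [drawFold, reservoirStep, h_lt, if_true, PMF.mem_support_bind_iff,
      PMF.mem_support_map_iff] at hy
    obtain ⟨_, ⟨t, -, rfl⟩, hy⟩ := hy
    rw [ih (by omega) _ hy]
    omega

lemma snd_of_mem_support_reservoir {vs : List V} {x y : ℕ × Option V}
    (hy : y ∈ (drawFold (reservoirStep cap) vs x).support) :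
    y.2 = x.2 ∨ ∃ v ∈ vs, y.2 = some v := by
  induction vs generalizing x with
  | nil => simp_all [drawFold]
  | cons v vs ih =>
    obtain ⟨z, hz, hy⟩ := (PMF.mem_support_bind_iff _ _ _).1 hy
    have h_step : z.2 = x.2 ∨ z.2 = some v := by
      unfold reservoirStep at hz
      split_ifs at hz
      · obtain ⟨t, -, rfl⟩ := (PMF.mem_support_map_iff _ _ _).1 hz
        rcases eq_or_ne t 0 with rfl | ht <;> simp [*]
      · exact Or.inl (congrArg Prod.snd ((PMF.mem_support_pure_iff _ _).1 hz))
    rcases ih hy with h | ⟨w, hw, h⟩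
    · exact h_step.imp (h.trans ·) fun hzv => ⟨v, List.mem_cons_self, h.trans hzv⟩
    · exact Or.inr ⟨w, List.mem_cons_of_mem _ hw, h⟩

lemma drawFold_reservoirStep_zero (vs : List V) (x : ℕ × Option V) :
    drawFold (reservoirStep 0) vs x = PMF.pure x := by
  induction vs with
  | nil => rfl
  | cons v vs ih => simp [drawFold, reservoirStep, ih]

end Reservoir

/-! ### A single trial -/

section Trial

variable {n k : ℕ}

/-- The state of a trial: its present set of vertices, the recorded edges inside this set, and a
reservoir of the outer ends of the edges that leave it. -/
abbrev Trial (n : ℕ) : Type := (Finset (Fin n) × Finset (Sym2 (Fin n))) × ℕ × Option (Fin n)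

/-- A trial between two passes. -/
def freshTrial (S : Finset (Fin n)) : Trial n := ((S, ∅), (0, none))

/-- The outer end of an edge that leaves `S` for a vertex where `d` is at most its maximum on
`S`. -/
def outerEnd (d : Fin n → ℕ) (S : Finset (Fin n)) (e : Sym2 (Fin n)) : Option (Fin n) :=
  if h : ∃ v, (∃ a ∈ S, e = s(a, v)) ∧ v ∉ S ∧ d v ≤ S.sup d then some h.choose else none

/-- A trial reads an edge. -/
def trialStep (d : Fin n → ℕ) (x : Trial n) (e : Sym2 (Fin n)) : PMF (Trial n) :=
  ((outerEnd d x.1.1 e).elim (PMF.pure x.2) (reservoirStep (#x.1.1 * x.1.1.sup d) x.2)).map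
    fun y => ((x.1.1, recordEdge x.1.1 x.1.2 e), y)

/-- The set with which a trial continues after a growth pass. One of `#S * S.sup d` slots is chosen,
of which each item seen by the reservoir occupies one; the trial fails, which is encoded by the
empty set, if an empty slot is chosen. -/
def growTrial (d : Fin n → ℕ) (x : Trial n) : PMF (Finset (Fin n)) :=
  (uniformBelow (#x.1.1 * x.1.1.sup d)).map fun t =>
    if t < x.2.1 then x.2.2.elim ∅ (insert · x.1.1) else ∅

/-- The law of the set of a trial after a growth pass over the stream `l`. -/
def growLaw (d : Fin n → ℕ) (l : List (Sym2 (Fin n))) (S : Finset (Fin n)) : PMF (Finset (Fin n)) :=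
  (drawFold (trialStep d) l (freshTrial S)).bind (growTrial d)

/-- The outcome of a trial that has reached the set `S`: the class of `S` is accepted with
probability inversely proportional to the number of ways in which `S` can grow. -/
def outcomeLaw (G : SimpleGraph (Fin n)) (d : Fin n → ℕ) (k : ℕ) (S : Finset (Fin n)) :
    PMF (Option (GraphletClass k)) :=
  (uniformBelow (growthCount G d (k - 1) S)).map fun t => if t = 0 then classOf k G S else none

/-- The outcome of a trial at the end of its last pass, computed from the recorded edges. -/
def trialOutcome (d : Fin n → ℕ) (k : ℕ) (x : Trial n) : PMF (Option (GraphletClass k)) :=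
  outcomeLaw (SimpleGraph.fromEdgeSet (x.1.2 : Set (Sym2 (Fin n)))) d k x.1.1

variable {G : SimpleGraph (Fin n)} {d : Fin n → ℕ} {S T : Finset (Fin n)}
  {l l' : List (Sym2 (Fin n))}

lemma outerEnd_eq_some_iff {e : Sym2 (Fin n)} {v : Fin n} :
    outerEnd d S e = some v ↔ (∃ a ∈ S, e = s(a, v)) ∧ v ∉ S ∧ d v ≤ S.sup d := by
  unfold outerEnd
  split_ifs with h
  · rw [Option.some_inj]
    refine ⟨fun hv => hv ▸ h.choose_spec, ?_⟩
    rintro ⟨⟨a, ha, rfl⟩, -⟩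
    obtain ⟨⟨b, -, hab⟩, hw, -⟩ := h.choose_spec
    rcases Sym2.eq_iff.1 hab with ⟨-, hv⟩ | ⟨ha', -⟩
    · exact hv.symm
    · exact absurd (ha' ▸ ha) hw
  · exact iff_of_false nofun fun h' => h ⟨v, h'⟩

lemma drawFold_trialStep (d : Fin n → ℕ) (S : Finset (Fin n)) (l : List (Sym2 (Fin n)))
    (E : Finset (Sym2 (Fin n))) (y : ℕ × Option (Fin n)) :
    drawFold (trialStep d) l ((S, E), y) =
      (drawFold (reservoirStep (#S * S.sup d)) (l.filterMap (outerEnd d S)) y).map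
        fun y' => ((S, l.foldl (recordEdge S) E), y') := by
  rw [← drawFold_filterMap]
  induction l generalizing E y with
  | nil => simp [drawFold, PMF.pure_map]
  | cons e l ih => simp [drawFold, trialStep, PMF.bind_map, PMF.map_bind, Function.comp_def, ih]

lemma count_filterMap_outerEnd (hl : IsEdgeStream G l) (d : Fin n → ℕ) (S : Finset (Fin n))
    (u : Fin n) : (l.filterMap (outerEnd d S)).count u =
      if u ∉ S ∧ d u ≤ S.sup d then linkCount G S u else 0 := by
  rw [List.count_filterMap, List.countP_eq_length_filter,
    ← List.toFinset_card_of_nodup (hl.1.filter _)]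
  split_ifs with h
  · refine (Finset.card_bij (fun a _ => s(a, u)) (fun a ha => ?_) (fun a ha b hb hab => ?_)
      fun e he => ?_).symm
    · obtain ⟨ha, hau⟩ := Finset.mem_filter.1 ha
      simp only [List.mem_toFinset, List.mem_filter, beq_iff_eq, hl.2, outerEnd_eq_some_iff]
      exact ⟨hau, ⟨a, ha, rfl⟩, h⟩
    · rcases Sym2.eq_iff.1 hab with ⟨hab, -⟩ | ⟨rfl, -⟩
      · exact hab
      · exact absurd (Finset.mem_filter.1 ha).1 h.1
    · simp only [List.mem_toFinset, List.mem_filter, beq_iff_eq, hl.2, outerEnd_eq_some_iff] at he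
      obtain ⟨he, ⟨a, ha, rfl⟩, -⟩ := he
      exact ⟨a, Finset.mem_filter.2 ⟨ha, he⟩, rfl⟩
  · rw [Finset.card_eq_zero, Finset.eq_empty_iff_forall_notMem]
    intro e he
    simp only [List.mem_toFinset, List.mem_filter, beq_iff_eq, outerEnd_eq_some_iff] at he
    exact h he.2.2

lemma sum_map_filterMap_outerEnd {R : Type*} [Semiring R] (hl : IsEdgeStream G l) (d : Fin n → ℕ)
    (S : Finset (Fin n)) (f : Fin n → R) : ((l.filterMap (outerEnd d S)).map f).sum =
      ∑ u ∈ Sᶜ with d u ≤ S.sup d, linkCount G S u * f u := by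
  rw [Finset.sum_list_map_count, Finset.sum_subset (Finset.subset_univ _) fun u _ hu => ?_]
  · have h_count (u : Fin n) := count_filterMap_outerEnd hl d S u
    simp only [h_count, nsmul_eq_mul, Nat.cast_ite, Nat.cast_zero, ite_mul, zero_mul,
      ← Finset.sum_filter]
    exact Finset.sum_congr (by ext; simp) fun _ _ => rfl
  · rw [List.count_eq_zero.2 (by simpa using hu), zero_smul]

lemma length_filterMap_outerEnd (hl : IsEdgeStream G l) (d : Fin n → ℕ) (S : Finset (Fin n)) :
    (l.filterMap (outerEnd d S)).length = ∑ u ∈ Sᶜ with d u ≤ S.sup d, linkCount G S u := by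
  simpa using sum_map_filterMap_outerEnd hl d S fun _ => (1 : ℕ)

lemma sum_linkCount (G : SimpleGraph (Fin n)) (S : Finset (Fin n)) :
    ∑ u, linkCount G S u = ∑ a ∈ S, G.degree a := by
  simp only [linkCount, Finset.card_filter]
  rw [Finset.sum_comm]
  refine Finset.sum_congr rfl fun a _ => ?_
  rw [← Finset.card_filter, ← G.card_neighborFinset_eq_degree, G.neighborFinset_eq_filter]

lemma sum_linkCount_le (hS : ∀ a ∈ S, G.degree a ≤ S.sup d) :
    ∑ u ∈ Sᶜ with d u ≤ S.sup d, linkCount G S u ≤ #S * S.sup d :=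
  calc _ ≤ ∑ u, linkCount G S u := Finset.sum_le_sum_of_subset (Finset.subset_univ _)
    _ = ∑ a ∈ S, G.degree a := sum_linkCount G S
    _ ≤ #S * S.sup d := Finset.sum_le_card_nsmul _ _ _ hS

lemma mul_expect_growLaw (hl : IsEdgeStream G l) (hS : ∀ a ∈ S, G.degree a ≤ S.sup d)
    (f : Finset (Fin n) → ℝ≥0∞) :
    (#S * S.sup d : ℕ) * expect (growLaw d l S) f =
      ∑ u ∈ Sᶜ with d u ≤ S.sup d, linkCount G S u * f (insert u S) +
        (#S * S.sup d - ∑ u ∈ Sᶜ with d u ≤ S.sup d, linkCount G S u : ℕ) * f ∅ := by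
  have h_length := length_filterMap_outerEnd hl d S
  have h_le := sum_linkCount_le hS
  rw [← h_length] at h_le ⊢
  set out := l.filterMap (outerEnd d S)
  have h_slots (y : ℕ × Option (Fin n))
      (hy : y ∈ (drawFold (reservoirStep (#S * S.sup d)) out (0, none)).support) :
      (#S * S.sup d : ℕ) * expect (growTrial d ((S, l.foldl (recordEdge S) ∅), y)) f =
        out.length * f (y.2.elim ∅ (insert · S)) + (#S * S.sup d - out.length : ℕ) * f ∅ := by
    obtain ⟨m, hm⟩ := Nat.exists_eq_add_of_le h_le
    have hy_fst : y.1 = out.length := by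
      simpa using fst_of_mem_support_reservoir (by rwa [zero_add]) none hy
    rw [growTrial, expect_map, mul_expect_uniformBelow, hy_fst, hm, Finset.sum_range_add,
      Finset.sum_congr rfl fun t ht => by rw [if_pos (Finset.mem_range.1 ht)]]
    simp
  rw [growLaw, freshTrial, drawFold_trialStep, expect_bind, expect_map, ← expect_const_mul,
    expect_congr _ h_slots, expect_add, expect_const, expect_const_mul]
  have h_reservoir := mul_expect_reservoir (fun o => f (o.elim ∅ (insert · S))) (vs := out) (c := 0)
    (cap := #S * S.sup d) (by rwa [zero_add]) none
  rw [zero_add, Nat.cast_zero, zero_mul, zero_add] at h_reservoir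
  rw [h_reservoir]
  congr 1
  exact sum_map_filterMap_outerEnd hl d S fun u => f (insert u S)

lemma mem_support_growLaw (hl : IsEdgeStream G l) (hT : T ∈ (growLaw d l S).support) :
    T = ∅ ∨ ∃ v ∉ S, (∃ a ∈ S, G.Adj a v) ∧ T = insert v S := by
  rw [growLaw, freshTrial, drawFold_trialStep] at hT
  simp only [PMF.mem_support_bind_iff, PMF.mem_support_map_iff, growTrial] at hT
  obtain ⟨_, ⟨⟨c, o⟩, hy, rfl⟩, t, -, rfl⟩ := hT
  rcases snd_of_mem_support_reservoir hy with rfl | ⟨v, hv, rfl⟩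
  · simp
  · obtain ⟨e, he, hev⟩ := List.mem_filterMap.1 hv
    obtain ⟨⟨a, ha, rfl⟩, hvS, -⟩ := outerEnd_eq_some_iff.1 hev
    split_ifs
    · exact Or.inr ⟨v, hvS, ⟨a, ha, (hl.2 _).1 he⟩, rfl⟩
    · exact Or.inl rfl

lemma growLaw_eq_pure_empty (h : #S * S.sup d = 0) : growLaw d l S = PMF.pure ∅ := by
  rw [growLaw, freshTrial, drawFold_trialStep, h, drawFold_reservoirStep_zero, PMF.pure_map,
    PMF.pure_bind, growTrial]
  exact PMF.map_const _ _

lemma growLaw_eq (hl : IsEdgeStream G l) (hl' : IsEdgeStream G l')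
    (hS : ∀ a ∈ S, G.degree a ≤ S.sup d) : growLaw d l S = growLaw d l' S := by
  by_cases h0 : #S * S.sup d = 0
  · rw [growLaw_eq_pure_empty h0, growLaw_eq_pure_empty h0]
  ext T
  rw [← expect_ite_eq, ← expect_ite_eq]
  refine (ENNReal.mul_right_inj (by exact_mod_cast h0) (ENNReal.natCast_ne_top _)).1 ?_
  rw [mul_expect_growLaw hl hS, mul_expect_growLaw hl' hS]

lemma expect_growLaw (hl : IsEdgeStream G l) (hS : ∀ a ∈ S, G.degree a ≤ S.sup d)
    {g : Finset (Fin n) → ℝ≥0} (hg : g ∅ = 0) :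
    expect (growLaw d l S) (fun T => g T) = growthStep G d g S := by
  by_cases h0 : #S * S.sup d = 0
  · simp [growLaw_eq_pure_empty h0, growthStep, h0, expect_pure, hg]
  refine (ENNReal.mul_right_inj (by exact_mod_cast h0) (ENNReal.natCast_ne_top _)).1 ?_
  rw [mul_expect_growLaw hl hS, hg, ENNReal.coe_zero, mul_zero, add_zero, growthStep,
    ← ENNReal.coe_natCast (#S * S.sup d), ← ENNReal.coe_mul,
    mul_div_cancel₀ _ (by exact_mod_cast h0)]
  push_cast
  rfl

lemma drawFold_bind_trialOutcome (hl : IsEdgeStream G l) (d : Fin n → ℕ) (k : ℕ)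
    (S : Finset (Fin n)) :
    (drawFold (trialStep d) l (freshTrial S)).bind (trialOutcome d k) = outcomeLaw G d k S := by
  set H := SimpleGraph.fromEdgeSet ((l.foldl (recordEdge S) ∅ : Finset _) : Set (Sym2 (Fin n)))
  have h_adj : ∀ a ∈ S, ∀ b ∈ S, H.Adj a b ↔ G.Adj a b := fun a ha b hb => hl.adj_recorded_iff ha hb
  calc _ = outcomeLaw H d k S := by
        rw [freshTrial, drawFold_trialStep, PMF.bind_map]
        exact PMF.bind_const _ (outcomeLaw H d k S)
    _ = outcomeLaw G d k S := by
        rw [outcomeLaw, outcomeLaw, classOf_congr h_adj, growthCount_congr h_adj]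

/-- The outcome of a trial that has reached the set `S` and has `j` growth passes left. -/
def trialFrom (G : SimpleGraph (Fin n)) (d : Fin n → ℕ) (k : ℕ) :
    ℕ → Finset (Fin n) → PMF (Option (GraphletClass k))
  | 0, S => outcomeLaw G d k S
  | j + 1, S => (growLaw d G.edgeFinset.toList S).bind (trialFrom G d k j)

/-- The outcome of a complete trial. -/
def trialLaw (G : SimpleGraph (Fin n)) (d : Fin n → ℕ) (k : ℕ) : PMF (Option (GraphletClass k)) :=
  (rootLaw d k).bind (trialFrom G d k (k - 1))

lemma isEdgeStream_toList (G : SimpleGraph (Fin n)) : IsEdgeStream G G.edgeFinset.toList :=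
  ⟨Finset.nodup_toList _, by simp⟩

lemma degree_le_sup_profile (hS : ∀ v ∈ S, Alive G k v) :
    ∀ a ∈ S, G.degree a ≤ S.sup (profile G k) := fun a ha =>
  (hS a ha).profile_eq.symm.le.trans (Finset.le_sup ha)

lemma alive_of_mem_support_growLaw (hl : IsEdgeStream G l) (hS : ∀ v ∈ S, Alive G k v)
    (hT : T ∈ (growLaw d l S).support) : ∀ v ∈ T, Alive G k v := by
  rcases mem_support_growLaw hl hT with rfl | ⟨v, -, ⟨a, ha, hav⟩, rfl⟩
  · simp
  · exact Finset.forall_mem_insert .. |>.2 ⟨(hS a ha).of_reachable hav.reachable, hS⟩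

lemma alive_of_mem_support_rootLaw (hk : 2 ≤ k) (hS : S ∈ (rootLaw (profile G k) k).support) :
    ∀ v ∈ S, Alive G k v := by
  rcases mem_support_rootLaw hk hS with rfl | ⟨v, rfl, hv⟩
  · simp
  · simpa using alive_of_profile_pos hv

/-- The probability that a trial that has reached the set `S` yields the class `i`. -/
def acceptProb (G : SimpleGraph (Fin n)) (d : Fin n → ℕ) {k : ℕ} (i : GraphletClass k)
    (S : Finset (Fin n)) : ℝ≥0 :=
  if classOf k G S = some i then (growthCount G d (k - 1) S : ℝ≥0)⁻¹ else 0

lemma growthCount_profile_pos (hk : 2 ≤ k) (hS : S ∈ graphlets G k) :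
    0 < growthCount G (profile G k) (k - 1) S :=
  growthCount_pos (by rwa [Nat.sub_add_cancel (by omega)])
    fun _ hv => (alive_of_mem_graphlets hS hv).profile_pos hk

lemma outcomeLaw_apply (hk : 2 ≤ k) (i : GraphletClass k) :
    outcomeLaw G (profile G k) k S (some i) = acceptProb G (profile G k) i S := by
  have h_count := mul_expect_uniformBelow (growthCount G (profile G k) (k - 1) S)
    fun t => if (if t = 0 then classOf k G S else none) = some i then 1 else 0
  rw [← expect_ite_eq, outcomeLaw, expect_map, acceptProb]
  split_ifs with h
  · have h_pos := growthCount_profile_pos hk (exists_classOf_eq_some_iff.1 ⟨i, h⟩)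
    rw [Finset.sum_eq_single_of_mem 0 (Finset.mem_range.2 h_pos) (by simp +contextual)] at h_count
    rw [ENNReal.coe_inv (by exact_mod_cast h_pos.ne'), ENNReal.coe_natCast]
    exact ENNReal.eq_inv_of_mul_eq_one_left ((mul_comm _ _).trans (by simpa [h] using h_count))
  · have h_ne (t : ℕ) : (if t = 0 then classOf k G S else none) ≠ some i := by
      split_ifs
      exacts [h, nofun]
    simp only [h_ne, if_false, expect_const, ENNReal.coe_zero]

lemma acceptProb_empty (hk : 0 < k) (i : GraphletClass k) : acceptProb G d i ∅ = 0 := by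
  refine if_neg fun h => ?_
  have h_card := (mem_graphlets.1 (exists_classOf_eq_some_iff.1 ⟨i, h⟩)).1
  exact hk.ne h_card

lemma trialFrom_apply (hk : 2 ≤ k) (i : GraphletClass k) (j : ℕ) (hS : ∀ v ∈ S, Alive G k v) :
    trialFrom G (profile G k) k j S (some i) =
      (growthStep G (profile G k))^[j] (acceptProb G (profile G k) i) S := by
  induction j generalizing S with
  | zero => exact outcomeLaw_apply hk i
  | succ j ih =>
    have h_empty : ((growthStep G (profile G k))^[j] (acceptProb G (profile G k) i)) ∅ = 0 := by
      cases j with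
      | zero => exact acceptProb_empty (by omega) i
      | succ j => simp [Function.iterate_succ_apply', growthStep]
    rw [Function.iterate_succ_apply', ← expect_growLaw (isEdgeStream_toList G)
      (degree_le_sup_profile hS) h_empty, ← expect_ite_eq, trialFrom, expect_bind]
    refine expect_congr _ fun T hT => ?_
    rw [expect_ite_eq, ih (alive_of_mem_support_growLaw (isEdgeStream_toList G) hS hT)]

/-- A trial yields each class with probability proportional to its number of graphlets: the growth
counts cancel against the acceptance probabilities. -/
lemma rootWeight_mul_trialLaw_apply (hk : 2 ≤ k) (G : SimpleGraph (Fin n)) (i : GraphletClass k) :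
    rootWeight (profile G k) k * trialLaw G (profile G k) k (some i) =
      ((graphletCount G i / (k - 1).factorial : ℝ≥0) : ℝ≥0∞) := by
  set g := (growthStep G (profile G k))^[k - 1] (acceptProb G (profile G k) i) with hg
  have h_law : trialLaw G (profile G k) k (some i) =
      expect (rootLaw (profile G k) k) fun S => g S := by
    rw [← expect_ite_eq, trialLaw, expect_bind]
    refine expect_congr _ fun S hS => ?_
    rw [expect_ite_eq, trialFrom_apply hk i _ (alive_of_mem_support_rootLaw hk hS)]
  have h_cancel (S : Finset (Fin n)) :
      (growthCount G (profile G k) (k - 1) S : ℝ≥0) * acceptProb G (profile G k) i S =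
        if S ∈ graphlets G k ∧ classOf k G S = some i then 1 else 0 := by
    by_cases h : classOf k G S = some i
    · have hS := exists_classOf_eq_some_iff.1 ⟨i, h⟩
      have h_pos := growthCount_profile_pos hk hS
      rw [acceptProb, if_pos h, if_pos ⟨hS, h⟩, mul_inv_cancel₀ (by exact_mod_cast h_pos.ne')]
    · simp [acceptProb, h]
  have h_sum := sum_pow_mul_iterate G (profile G k) (acceptProb G (profile G k) i)
    (j := k - 1) (by omega)
  rw [← Finset.sum_div, Finset.sum_congr rfl fun S _ => h_cancel S, Finset.sum_boole,
    ← Finset.filter_filter, Finset.filter_mem_eq_inter, Finset.univ_inter,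
    ← graphletCount_eq_card, ← hg] at h_sum
  rw [h_law, rootWeight_mul_expect_rootLaw, ← h_sum]
  push_cast
  rfl

end Trial

/-! ### The sampling machine -/

section SamplingMachine

variable {n k : ℕ}

/-- The state of the sampling phase: the degree profile, the numbers of outcomes so far, the number
of rounds and the number of growth passes of the present round that are left, and the trials. -/
structure SampState (n k : ℕ) where
  deg : Fin n → ℕ
  cnt : GraphletClass k → ℕ
  rounds : ℕ
  stage : ℕ
  trials : List (Trial n)

/-- The state between two passes in which the trials have reached the given sets. -/
def SampState.between (d : Fin n → ℕ) (c : GraphletClass k → ℕ) (r j : ℕ)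
    (Ss : List (Finset (Fin n))) : SampState n k := ⟨d, c, r, j, Ss.map freshTrial⟩

/-- The roots of `b` independent trials. -/
def rootsLaw (d : Fin n → ℕ) (k b : ℕ) : PMF (List (Finset (Fin n))) :=
  drawList id (List.replicate b (rootLaw d k))

/-- Add the outcomes of a round of trials to the counters. -/
def addOutcomes (c : GraphletClass k → ℕ) (os : List (Option (GraphletClass k)))
    (i : GraphletClass k) : ℕ := c i + os.count (some i)

/-- The machine that makes rounds of `b` parallel trials each, where a round consists of `k - 1`
growth passes and a pass that computes the outcomes. -/
def sampMachine (n k b : ℕ) : Machine n (SampState n k) where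
  step x e := (drawList (trialStep x.deg · e) x.trials).map fun ts => { x with trials := ts }
  endPass x := match x.rounds, x.stage with
    | 0, _ => PMF.pure x
    | r + 1, 0 => (drawList (trialOutcome x.deg k) x.trials).bind fun os =>
        (rootsLaw x.deg k b).map (.between x.deg (addOutcomes x.cnt os) r (k - 1))
    | r + 1, j + 1 => (drawList (growTrial x.deg) x.trials).map (.between x.deg x.cnt (r + 1) j)
  left x := match x.rounds with
    | 0 => 0
    | r + 1 => r * k + x.stage + 1

variable {G : SimpleGraph (Fin n)} {l : List (Sym2 (Fin n))} {d : Fin n → ℕ}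
  {c : GraphletClass k → ℕ} {b Q r j : ℕ} {S : Finset (Fin n)} {Ss : List (Finset (Fin n))}

lemma drawFold_sampMachine (b : ℕ) (l : List (Sym2 (Fin n))) (x : SampState n k) :
    drawFold (sampMachine n k b).step l x =
      (drawList (drawFold (trialStep x.deg) l) x.trials).map fun ts => { x with trials := ts } := by
  rw [← drawFold_drawList]
  induction l generalizing x with
  | nil => simp [drawFold, PMF.pure_map]
  | cons e l ih =>
    have h_step : (sampMachine n k b).step x e = (drawList (trialStep x.deg · e) x.trials).map
      fun ts => { x with trials := ts } := rfl
    rw [drawFold, drawFold, h_step, PMF.bind_map, PMF.map_bind]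
    exact congrArg _ (funext fun ts => ih _)

lemma sampMachine_pass_growth (b : ℕ) (l : List (Sym2 (Fin n))) (d : Fin n → ℕ)
    (c : GraphletClass k → ℕ) (r j : ℕ) (Ss : List (Finset (Fin n))) :
    (sampMachine n k b).pass l (.between d c (r + 1) (j + 1) Ss) =
      (drawList (growLaw d l) Ss).map (.between d c (r + 1) j) := by
  rw [Machine.pass, drawFold_sampMachine, PMF.bind_map]
  have h_grow : drawList (growLaw d l) Ss =
      (drawList (fun S => drawFold (trialStep d) l (freshTrial S)) Ss).bind
        (drawList (growTrial d)) := (drawList_bind _ _ _).symm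
  simp only [h_grow, Function.comp_def, sampMachine, SampState.between, drawList_comp,
    PMF.map_bind]

lemma sampMachine_pass_outcome (hl : IsEdgeStream G l) (b : ℕ) (d : Fin n → ℕ)
    (c : GraphletClass k → ℕ) (r : ℕ) (Ss : List (Finset (Fin n))) :
    (sampMachine n k b).pass l (.between d c (r + 1) 0 Ss) =
      (drawList (outcomeLaw G d k) Ss).bind fun os =>
        (rootsLaw d k b).map (.between d (addOutcomes c os) r (k - 1)) := by
  rw [Machine.pass, drawFold_sampMachine, PMF.bind_map,
    ← drawList_congr fun S _ => drawFold_bind_trialOutcome hl d k S, ← drawList_bind,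
    PMF.bind_bind]
  simp only [Function.comp_def, sampMachine, SampState.between, drawList_comp]

lemma length_of_mem_support_rootsLaw (h : Ss ∈ (rootsLaw d k b).support) : Ss.length = b := by
  simpa using length_of_mem_support_drawList h

lemma mem_support_rootLaw_of_mem (h : Ss ∈ (rootsLaw d k b).support) (hS : S ∈ Ss) :
    S ∈ (rootLaw d k).support := by
  obtain ⟨p, hp, hSp⟩ := exists_of_mem_support_drawList h hS
  rwa [← List.eq_of_mem_replicate hp]

/-! ### The memory of the sampling machine -/

lemma Fits.card_le (n κ : ℕ) : Fits {S : Finset (Fin n) | #S ≤ κ} (κ * wordSize n) := by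
  have h_option : Fits ((Finset.univ : Finset (Option (Fin n))) : Set (Option (Fin n)))
      (wordSize n) := .finset (by simpa using lt_two_pow_wordSize (n := n) le_rfl)
  have h_pi := (h_option.pi (ι := Fin κ)).image fun f => ({v | ∃ j, f j = some v} : Finset (Fin n))
  rw [Fintype.card_fin] at h_pi
  refine h_pi.mono (fun S hS => ⟨fun j => S.toList[j]?, by simp, ?_⟩) le_rfl
  ext v
  simp only [Finset.mem_filter, Finset.mem_univ, true_and, ← Finset.mem_toList (s := S),
    List.mem_iff_getElem?]
  refine ⟨fun ⟨j, hj⟩ => ⟨j, hj⟩, fun ⟨i, hi⟩ => ⟨⟨i, ?_⟩, hi⟩⟩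
  have h_lt := (List.getElem?_eq_some_iff.1 hi).1
  exact (h_lt.trans_eq S.length_toList).trans_le hS

/-- The states of a trial whose set has at most `κ` elements. -/
def trialStates (n κ : ℕ) : Set (Trial n) :=
  {τ | (#τ.1.1 ≤ κ ∧ τ.1.2 ⊆ τ.1.1.sym2) ∧ τ.2.1 ≤ n * n}

lemma trialStates_fits (n κ : ℕ) :
    Fits (trialStates n κ) (κ * wordSize n + κ * κ + (2 * wordSize n + wordSize n)) := by
  have h_sets : Fits {p : Finset (Fin n) × Finset (Sym2 (Fin n)) | #p.1 ≤ κ ∧ p.2 ⊆ p.1.sym2}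
      (κ * wordSize n + κ * κ) := (Fits.card_le n κ).sigma fun _ hS => Fits.subset_sym2 hS
  have h_count : Fits {i | i < n * n + 1} (2 * wordSize n) := by
    have h_lt : n < 2 ^ wordSize n := lt_two_pow_wordSize le_rfl
    refine Fits.nat_lt (Nat.succ_le_of_lt ?_)
    rw [two_mul, pow_add]
    exact Nat.mul_lt_mul'' h_lt h_lt
  have h_option : Fits ((Finset.univ : Finset (Option (Fin n))) : Set (Option (Fin n)))
      (wordSize n) := .finset (by simpa using lt_two_pow_wordSize (n := n) le_rfl)
  exact (h_sets.prod (h_count.prod h_option)).mono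
    (fun τ hτ => ⟨hτ.1, Nat.lt_succ_of_le hτ.2, Finset.mem_coe.2 (Finset.mem_univ _)⟩) le_rfl

/-- The states of the sampling machine from which at most `Q` rounds of `b` trials are made. -/
def sampStates (n k b Q : ℕ) : Set (SampState n k) :=
  {x | (∀ v, x.deg v ≤ n) ∧ (∀ i, x.cnt i + x.rounds * b ≤ Q * b) ∧ x.rounds ≤ Q ∧ x.stage < k ∧
    x.trials.length = b ∧ ∀ τ ∈ x.trials, τ ∈ trialStates n (k - x.stage)}

lemma trialStates_mono {κ κ' : ℕ} (h : κ ≤ κ') : trialStates n κ ⊆ trialStates n κ' :=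
  fun _ hτ => ⟨⟨hτ.1.1.trans h, hτ.1.2⟩, hτ.2⟩

lemma sampStates_fits {w : ℕ} (hk : k ≤ n) (hb : 0 < b) (hQ : Q * b < 2 ^ w) :
    Fits (sampStates n k b Q) (n * wordSize n + (Fintype.card (GraphletClass k) * w + (w +
      (wordSize n + b * (k * wordSize n + k * k + (2 * wordSize n + wordSize n)))))) := by
  have h_le : Fits {i | i < Q * b + 1} w := Fits.nat_lt (Nat.succ_le_of_lt hQ)
  have h_stage : Fits {i | i < k} (wordSize n) := Fits.nat_lt (lt_two_pow_wordSize hk).le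
  refine (((Fits.forall_le n).prod ((h_le.pi (ι := GraphletClass k)).prod (h_le.prod
    (h_stage.prod ((trialStates_fits n k).list b))))).image
      fun p => (⟨p.1, p.2.1, p.2.2.1, p.2.2.2.1, p.2.2.2.2⟩ : SampState n k)).mono ?_ le_rfl
  rintro ⟨d, c, r, j, ts⟩ ⟨hd, hc, hr, hj, h_length, hts⟩
  refine ⟨(d, c, r, j, ts), ⟨hd, fun i => Nat.lt_succ_of_le ?_, Nat.lt_succ_of_le ?_, hj, h_length,
    fun τ hτ => trialStates_mono (Nat.sub_le _ _) (hts τ hτ)⟩, rfl⟩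
  · exact (Nat.le_add_right _ _).trans (hc i)
  · exact hr.trans (Nat.le_mul_of_pos_right _ hb)

lemma freshTrial_mem {κ : ℕ} (h : #S ≤ κ) : freshTrial S ∈ trialStates n κ :=
  ⟨⟨h, Finset.empty_subset _⟩, Nat.zero_le _⟩

lemma trialStep_mem {κ : ℕ} (hd : ∀ v, d v ≤ n) {τ : Trial n} (hτ : τ ∈ trialStates n κ)
    (e : Sym2 (Fin n)) : (trialStep d τ e).support ⊆ trialStates n κ := by
  intro y hy
  obtain ⟨z, hz, rfl⟩ := (PMF.mem_support_map_iff _ _ _).1 hy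
  refine ⟨⟨hτ.1.1, recordEdge_subset hτ.1.2 e⟩, ?_⟩
  have h_slots : #τ.1.1 * τ.1.1.sup d ≤ n * n :=
    Nat.mul_le_mul (by simpa using τ.1.1.card_le_univ) (Finset.sup_le fun v _ => hd v)
  cases h : outerEnd d τ.1.1 e with
  | none =>
    rw [h, Option.elim_none, PMF.mem_support_pure_iff] at hz
    exact hz ▸ hτ.2
  | some v =>
    rw [h, Option.elim_some, reservoirStep] at hz
    split_ifs at hz with h_lt
    · obtain ⟨t, -, rfl⟩ := (PMF.mem_support_map_iff _ _ _).1 hz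
      exact (Nat.succ_le_of_lt h_lt).trans h_slots
    · exact (PMF.mem_support_pure_iff _ _).1 hz ▸ hτ.2

lemma card_le_of_mem_support_growTrial {τ : Trial n} (hS : S ∈ (growTrial d τ).support) :
    #S ≤ #τ.1.1 + 1 := by
  obtain ⟨t, -, rfl⟩ := (PMF.mem_support_map_iff _ _ _).1 hS
  split_ifs
  · cases τ.2.2 with
    | none => simp
    | some v => exact Finset.card_insert_le v τ.1.1
  · simp

lemma between_mem_sampStates (hd : ∀ v, d v ≤ n) (hk : 2 ≤ k) (hc : ∀ i, c i + r * b ≤ Q * b)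
    (hr : r ≤ Q) (hSs : Ss ∈ (rootsLaw d k b).support) :
    .between d c r (k - 1) Ss ∈ sampStates n k b Q := by
  refine ⟨hd, hc, hr, by simp only [SampState.between]; omega,
    by simpa [SampState.between] using length_of_mem_support_rootsLaw hSs, fun τ hτ => ?_⟩
  obtain ⟨S, hS, rfl⟩ := List.mem_map.1 hτ
  refine freshTrial_mem ?_
  rcases mem_support_rootLaw hk (mem_support_rootLaw_of_mem hSs hS) with rfl | ⟨v, rfl, -⟩
  · simp
  · simp only [Finset.card_singleton, SampState.between]
    omega

lemma sampMachine_step_mem {x : SampState n k} (hx : x ∈ sampStates n k b Q) (e : Sym2 (Fin n)) :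
    ((sampMachine n k b).step x e).support ⊆ sampStates n k b Q := by
  rintro y hy
  obtain ⟨hd, hc, hr, hj, h_length, hτ⟩ := hx
  obtain ⟨ts, hts, rfl⟩ := (PMF.mem_support_map_iff _ _ _).1 hy
  refine ⟨hd, hc, hr, hj, (length_of_mem_support_drawList hts).trans h_length, fun τ h => ?_⟩
  obtain ⟨τ', hτ', h_step⟩ := exists_of_mem_support_drawList hts h
  exact trialStep_mem hd (hτ τ' hτ') e h_step

lemma sampMachine_endPass_mem (hk : 2 ≤ k) {x : SampState n k} (hx : x ∈ sampStates n k b Q) :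
    ((sampMachine n k b).endPass x).support ⊆ sampStates n k b Q := by
  rintro y hy
  obtain ⟨d, c, r, j, ts⟩ := x
  obtain ⟨hd, hc, hr, hj, h_length, hτ⟩ := hx
  rcases r with _ | r
  · obtain rfl := (PMF.mem_support_pure_iff _ _).1 hy
    exact ⟨hd, hc, hr, hj, h_length, hτ⟩
  rcases j with _ | j
  · simp only [sampMachine, PMF.mem_support_bind_iff, PMF.mem_support_map_iff] at hy
    obtain ⟨os, hos, Ss, hSs, rfl⟩ := hy
    refine between_mem_sampStates hd hk (fun i => ?_) (Nat.le_of_succ_le hr) hSs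
    have h_count : os.count (some i) ≤ b := List.count_le_length.trans_eq
      ((length_of_mem_support_drawList hos).trans h_length)
    calc c i + os.count (some i) + r * b ≤ c i + b + r * b := by gcongr
      _ = c i + (r + 1) * b := by ring
      _ ≤ Q * b := hc i
  · obtain ⟨Ss, hSs, rfl⟩ := (PMF.mem_support_map_iff _ _ _).1 hy
    refine ⟨hd, hc, hr, Nat.lt_of_succ_lt hj, ?_, fun τ h => ?_⟩
    · simpa [SampState.between] using (length_of_mem_support_drawList hSs).trans h_length
    · obtain ⟨S, hS, rfl⟩ := List.mem_map.1 h
      obtain ⟨τ', hτ', h_grow⟩ := exists_of_mem_support_drawList hSs hS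
      have h_card := card_le_of_mem_support_growTrial h_grow
      have h_card' := (hτ τ' hτ').1.1
      refine freshTrial_mem ?_
      simp only [SampState.between] at hj h_card' ⊢
      omega

lemma sampMachine_closed (hk : 2 ≤ k) (b Q : ℕ) :
    (sampMachine n k b).Closed (sampStates n k b Q) :=
  ⟨fun _ hx e => sampMachine_step_mem hx e, fun _ hx => sampMachine_endPass_mem hk hx⟩

/-! ### The potential of the sampling machine -/

/-- Between two passes, the trials consist of vertices in large components. -/
def SampInvariant (G : SimpleGraph (Fin n)) (x : SampState n k) : Prop :=
  ∃ c r j Ss, x = .between (profile G k) c r j Ss ∧ ∀ S ∈ Ss, ∀ v ∈ S, Alive G k v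

lemma sampInvariant_between (hk : 2 ≤ k) (c : GraphletClass k → ℕ) (r : ℕ)
    (hSs : Ss ∈ (rootsLaw (profile G k) k b).support) :
    SampInvariant G (.between (profile G k) c r (k - 1) Ss) :=
  ⟨c, r, k - 1, Ss, rfl, fun _ hS =>
    alive_of_mem_support_rootLaw hk (mem_support_rootLaw_of_mem hSs hS)⟩

lemma sampMachine_left_between (hk : 0 < k) (d : Fin n → ℕ) (c : GraphletClass k → ℕ) (r : ℕ)
    (Ss : List (Finset (Fin n))) :
    (sampMachine n k b).left (.between d c r (k - 1) Ss) = r * k := by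
  cases r with
  | zero => exact (Nat.zero_mul k).symm
  | succ r =>
    simp only [sampMachine, SampState.between, add_one_mul]
    omega

lemma sampMachine_isInvariant (hk : 2 ≤ k) (b : ℕ) (G : SimpleGraph (Fin n)) :
    (sampMachine n k b).IsInvariant G (SampInvariant G) := by
  rintro x ⟨c, _ | r, j, Ss, rfl, hSs⟩ hx l hl y hy
  · exact absurd rfl hx
  rcases j with _ | j
  · simp only [sampMachine_pass_outcome hl, PMF.mem_support_bind_iff,
      PMF.mem_support_map_iff] at hy
    obtain ⟨os, -, Ts, hTs, rfl⟩ := hy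
    refine ⟨sampInvariant_between hk _ r hTs, ?_⟩
    rw [sampMachine_left_between (by omega)]
    rfl
  · rw [sampMachine_pass_growth, PMF.mem_support_map_iff] at hy
    obtain ⟨Ts, hTs, rfl⟩ := hy
    refine ⟨⟨c, r + 1, j, Ts, rfl, fun T hT => ?_⟩, rfl⟩
    obtain ⟨S, hS, hTS⟩ := exists_of_mem_support_drawList hTs hT
    exact alive_of_mem_support_growLaw hl (hSs S hS) hTS

/-- The product of the weights `y` of the counted outcomes. -/
def countWeight (y : Option (GraphletClass k) → ℝ≥0∞) (c : GraphletClass k → ℕ) : ℝ≥0∞ :=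
  ∏ i, y (some i) ^ c i

lemma countWeight_addOutcomes {y : Option (GraphletClass k) → ℝ≥0∞} (hy : y none = 1)
    (c : GraphletClass k → ℕ) (os : List (Option (GraphletClass k))) :
    countWeight y (addOutcomes c os) = countWeight y c * (os.map y).prod := by
  have h_outcomes : ∏ o ∈ os.toFinset, y o ^ os.count o = ∏ o, y o ^ os.count o :=
    Finset.prod_subset (Finset.subset_univ _) fun o _ ho => by
      rw [List.count_eq_zero.2 (by simpa using ho), pow_zero]
  simp only [countWeight, addOutcomes, pow_add, Finset.prod_mul_distrib]
  congr 1
  calc ∏ i, y (some i) ^ os.count (some i) = ∏ o, y o ^ os.count o := by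
        rw [Fintype.prod_option, hy, one_pow, one_mul]
    _ = (os.map y).prod := by rw [← h_outcomes, Finset.prod_list_map_count]; congr!

/-- The expected final weight of the counters, given the present state. It is a martingale. -/
def sampPotential (G : SimpleGraph (Fin n)) (b : ℕ) (y : Option (GraphletClass k) → ℝ≥0∞)
    (x : SampState n k) : ℝ≥0∞ :=
  countWeight y x.cnt * match x.rounds with
    | 0 => 1
    | r + 1 =>
      (x.trials.map fun τ => expect (trialFrom G (profile G k) k x.stage τ.1.1) y).prod *
        (expect (trialLaw G (profile G k) k) y ^ b) ^ r

variable {y : Option (GraphletClass k) → ℝ≥0∞}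

lemma sampPotential_between (G : SimpleGraph (Fin n)) (b : ℕ)
    (y : Option (GraphletClass k) → ℝ≥0∞) (d : Fin n → ℕ) (c : GraphletClass k → ℕ) (r j : ℕ)
    (Ss : List (Finset (Fin n))) :
    sampPotential G b y (.between d c (r + 1) j Ss) = countWeight y c *
      ((Ss.map fun S => expect (trialFrom G (profile G k) k j S) y).prod *
        (expect (trialLaw G (profile G k) k) y ^ b) ^ r) := by
  simp [sampPotential, SampState.between, Function.comp_def, freshTrial]

lemma expect_sampPotential_roots (G : SimpleGraph (Fin n)) (b : ℕ)
    (y : Option (GraphletClass k) → ℝ≥0∞) (d : Fin n → ℕ) (c : GraphletClass k → ℕ) (r : ℕ) :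
    expect (rootsLaw (profile G k) k b)
        (fun Ss => sampPotential G b y (.between d c r (k - 1) Ss)) =
      countWeight y c * (expect (trialLaw G (profile G k) k) y ^ b) ^ r := by
  cases r with
  | zero => simp [sampPotential, SampState.between, expect_const]
  | succ r =>
    simp only [sampPotential_between, expect_const_mul, expect_mul_const, rootsLaw,
      expect_drawList_prod, trialLaw, expect_bind, List.map_replicate, List.prod_replicate, id_eq,
      pow_succ']

lemma expect_pass_sampPotential (hl : IsEdgeStream G l) (hy : y none = 1) {x : SampState n k}
    (hx : SampInvariant G x) (h_left : (sampMachine n k b).left x ≠ 0) :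
    expect ((sampMachine n k b).pass l x) (sampPotential G b y) = sampPotential G b y x := by
  obtain ⟨c, _ | r, j, Ss, rfl, hSs⟩ := hx
  · exact absurd rfl h_left
  rw [sampPotential_between]
  rcases j with _ | j
  · simp only [sampMachine_pass_outcome hl, expect_bind, expect_map, expect_sampPotential_roots,
      countWeight_addOutcomes hy, expect_mul_const, expect_const_mul, expect_drawList_prod,
      mul_assoc, trialFrom]
  · simp only [sampMachine_pass_growth, expect_map, sampPotential_between, expect_const_mul,
      expect_mul_const, expect_drawList_prod]
    congr 3
    refine List.map_congr_left fun S hS => ?_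
    rw [trialFrom, expect_bind, growLaw_eq hl (isEdgeStream_toList G)
      (degree_le_sup_profile (hSs S hS))]

end SamplingMachine

/-! ### Concentration of the estimate -/

section Concentration

variable {ι : Type*} {n k : ℕ} {G : SimpleGraph (Fin n)} {α δ ε μ : ℝ}

lemma expect_ofReal_option [Fintype ι] (p : PMF (Option ι)) {f : Option ι → ℝ} (hf : ∀ o, 0 ≤ f o)
    (h_none : f none = 1) :
    expect p (fun o => ENNReal.ofReal (f o)) =
      ENNReal.ofReal (1 + ∑ i, (p (some i)).toReal * (f (some i) - 1)) := by
  have h_sum : ∑ o, (p o).toReal = 1 := by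
    rw [← ENNReal.toReal_sum fun o _ => p.apply_ne_top o, ← tsum_fintype (L := .unconditional _),
      p.tsum_coe, ENNReal.toReal_one]
  have h_real : 1 + ∑ i, (p (some i)).toReal * (f (some i) - 1) = ∑ o, (p o).toReal * f o := by
    rw [Fintype.sum_option] at h_sum
    simp only [Fintype.sum_option, h_none, mul_sub, mul_one, Finset.sum_sub_distrib]
    linarith
  rw [expect_fintype, h_real, ENNReal.ofReal_sum_of_nonneg fun o _ => mul_nonneg (by simp) (hf o)]
  refine Finset.sum_congr rfl fun o _ => ?_
  rw [ENNReal.ofReal_mul ENNReal.toReal_nonneg, ENNReal.ofReal_toReal (p.apply_ne_top o)]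

/-- The exponent of the weight that detects a deviation of the frequency of `i` from `μ` by more
than `α` in the direction `ε`. The factor `α / 8` makes its mean `-α ^ 2 / 8`, of which the second
order term of the exponential costs at most half. -/
def tiltExponent (α μ ε : ℝ) (i j : ι) : ℝ := α / 8 * (ε * ((if j = i then 1 else 0) - μ) - α)

/-- The exponential weight of the outcome of a trial. Unsuccessful trials have weight `1`. -/
def tilt (α μ ε : ℝ) (i : ι) (o : Option ι) : ℝ :=
  o.elim 1 fun j => Real.exp (tiltExponent α μ ε i j)

lemma tilt_nonneg (α μ ε : ℝ) (i : ι) : ∀ o, 0 ≤ tilt α μ ε i o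
  | none => zero_le_one
  | some _ => (Real.exp_pos _).le

lemma sum_mul_tiltExponent [Fintype ι] (α μ ε : ℝ) (i : ι) (w : ι → ℝ) :
    ∑ j, w j * tiltExponent α μ ε i j = α / 8 * (ε * (w i - μ * ∑ j, w j) - α * ∑ j, w j) := by
  have h_term (j : ι) : w j * tiltExponent α μ ε i j =
      α / 8 * ε * (if j = i then w j else 0) - α / 8 * (ε * μ + α) * w j := by
    unfold tiltExponent
    split_ifs <;> ring
  simp only [h_term, Finset.sum_sub_distrib, ← Finset.mul_sum, Finset.sum_ite_eq', Finset.mem_univ,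
    if_true]
  ring

lemma abs_tiltExponent_le (hα : 0 < α) (hα1 : α < 1) (hε : |ε| = 1) (hμ : μ ∈ Set.Icc 0 1)
    (i j : ι) : |tiltExponent α μ ε i j| ≤ α / 4 := by
  have h_indicator : |(if j = i then 1 else 0) - μ| ≤ 1 := by
    rw [abs_le]
    split_ifs <;> constructor <;> linarith [hμ.1, hμ.2]
  calc |tiltExponent α μ ε i j| = α / 8 * |ε * ((if j = i then 1 else 0) - μ) - α| := by
        rw [tiltExponent, abs_mul, abs_of_pos (by positivity)]
    _ ≤ α / 8 * (|ε * ((if j = i then 1 else 0) - μ)| + |α|) := by gcongr; exact abs_sub _ _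
    _ ≤ α / 8 * (1 + 1) := by
        rw [abs_mul, hε, one_mul, abs_of_pos hα]
        gcongr
    _ = α / 4 := by ring

lemma sum_mul_tilt_sub_one_le [Fintype ι] (hα : 0 < α) (hα1 : α < 1) (hε : |ε| = 1)
    (hμ : μ ∈ Set.Icc 0 1) {w : ι → ℝ} (hw : ∀ j, 0 ≤ w j) {i : ι} (hi : w i = μ * ∑ j, w j) :
    ∑ j, w j * (tilt α μ ε i (some j) - 1) ≤ -((∑ j, w j) * (α ^ 2 / 16)) := by
  have h_exp (j : ι) : tilt α μ ε i (some j) - 1 ≤ tiltExponent α μ ε i j + α ^ 2 / 16 := by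
    have h_abs := abs_tiltExponent_le hα hα1 hε hμ i j
    have h_taylor := (abs_le.1 (Real.abs_exp_sub_one_sub_id_le (h_abs.trans (by linarith)))).2
    have h_sq : tiltExponent α μ ε i j ^ 2 ≤ (α / 4) ^ 2 := sq_le_sq' (abs_le.1 h_abs).1
      (abs_le.1 h_abs).2
    calc tilt α μ ε i (some j) - 1
        ≤ tiltExponent α μ ε i j + tiltExponent α μ ε i j ^ 2 := by
          simp only [tilt, Option.elim_some]
          linarith
      _ ≤ tiltExponent α μ ε i j + α ^ 2 / 16 := by linarith
  calc ∑ j, w j * (tilt α μ ε i (some j) - 1)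
      ≤ ∑ j, w j * (tiltExponent α μ ε i j + α ^ 2 / 16) :=
        Finset.sum_le_sum fun j _ => mul_le_mul_of_nonneg_left (h_exp j) (hw j)
    _ = -((∑ j, w j) * (α ^ 2 / 16)) := by
        simp only [mul_add, Finset.sum_add_distrib, ← Finset.sum_mul]
        rw [sum_mul_tiltExponent, hi]
        ring

lemma graphletDist_mem_Icc (G : SimpleGraph (Fin n)) (i : GraphletClass k) :
    graphletDist G i ∈ Set.Icc 0 1 := by
  refine ⟨by unfold graphletDist; positivity, div_le_one_of_le₀ ?_ (by positivity)⟩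
  exact_mod_cast Finset.single_le_sum (f := graphletCount G) (fun _ _ => Nat.zero_le _)
    (Finset.mem_univ i)

lemma rootWeight_pos_of_numGraphlets_pos (hk : 2 ≤ k) (hG : 0 < numGraphlets k G) :
    0 < rootWeight (profile G k) k :=
  rootWeight_profile_pos hk (Finset.card_pos.1 (by rwa [← numGraphlets_eq_card]))

lemma toReal_trialLaw_some (hk : 2 ≤ k) (hG : 0 < numGraphlets k G) (i : GraphletClass k) :
    (trialLaw G (profile G k) k (some i)).toReal =
      graphletCount G i / (rootWeight (profile G k) k * (k - 1).factorial) := by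
  have h_pos : (0 : ℝ) < rootWeight (profile G k) k := by
    exact_mod_cast rootWeight_pos_of_numGraphlets_pos hk hG
  have h_eq := congrArg ENNReal.toReal (rootWeight_mul_trialLaw_apply hk G i)
  simp only [ENNReal.toReal_mul, ENNReal.toReal_natCast, ENNReal.coe_toReal, NNReal.coe_div,
    NNReal.coe_natCast] at h_eq
  rw [mul_comm (rootWeight _ _ : ℝ), ← div_div, ← h_eq]
  field_simp

lemma rootWeight_mul_factorial_le (hk : 2 ≤ k) (G : SimpleGraph (Fin n)) :
    rootWeight (profile G k) k * (k - 1).factorial ≤ k ^ (4 * k) * numGraphlets k G :=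
  calc rootWeight (profile G k) k * (k - 1).factorial
      ≤ k ^ (2 * k) * (k * numGraphlets k G) * k ^ k := by
        rw [numGraphlets_eq_card]
        exact Nat.mul_le_mul (rootWeight_profile_le hk)
          ((Nat.factorial_le (Nat.sub_le _ _)).trans (Nat.factorial_le_pow k))
    _ = k ^ (3 * k + 1) * numGraphlets k G := by ring
    _ ≤ k ^ (4 * k) * numGraphlets k G := by gcongr <;> omega

lemma expect_trialLaw_tilt_le (hk : 2 ≤ k) (hα : 0 < α) (hα1 : α < 1) (hε : |ε| = 1)
    (hG : 0 < numGraphlets k G) (i : GraphletClass k) :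
    expect (trialLaw G (profile G k) k)
        (fun o => ENNReal.ofReal (tilt α (graphletDist G i) ε i o)) ≤
      ENNReal.ofReal (Real.exp (-(α ^ 2 / (16 * (k : ℝ) ^ (4 * k))))) := by
  have hZ_le : (rootWeight (profile G k) k * (k - 1).factorial : ℝ) ≤
      (k : ℝ) ^ (4 * k) * numGraphlets k G := by exact_mod_cast rootWeight_mul_factorial_le hk G
  have hZ_pos : (0 : ℝ) < rootWeight (profile G k) k * (k - 1).factorial := by
    exact_mod_cast Nat.mul_pos (rootWeight_pos_of_numGraphlets_pos hk hG) (Nat.factorial_pos _)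
  set Z : ℝ := rootWeight (profile G k) k * (k - 1).factorial with hZ
  have h_total : ∑ j : GraphletClass k, (graphletCount G j : ℝ) = numGraphlets k G :=
    (Nat.cast_sum _ _).symm
  have h_mean : (graphletCount G i : ℝ) =
      graphletDist G i * ∑ j : GraphletClass k, (graphletCount G j : ℝ) := by
    rw [h_total, graphletDist, div_mul_cancel₀ _ (by exact_mod_cast hG.ne')]
  have h_gain := sum_mul_tilt_sub_one_le hα hα1 hε (graphletDist_mem_Icc G i)
    (fun j => Nat.cast_nonneg (graphletCount G j)) h_mean
  rw [h_total] at h_gain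
  rw [expect_ofReal_option _ (tilt_nonneg _ _ _ i) rfl]
  refine ENNReal.ofReal_le_ofReal (le_trans ?_ (Real.add_one_le_exp _))
  simp only [toReal_trialLaw_some hk hG, ← hZ, div_mul_eq_mul_div, ← Finset.sum_div]
  rw [add_comm]
  gcongr
  have : (0 : ℝ) < k := by exact_mod_cast (by omega : 0 < k)
  rw [div_le_iff₀ hZ_pos]
  refine h_gain.trans ?_
  rw [neg_mul, neg_le_neg_iff, div_mul_eq_mul_div, div_le_iff₀ (by positivity)]
  calc α ^ 2 * Z ≤ α ^ 2 * ((k : ℝ) ^ (4 * k) * numGraphlets k G) := by gcongr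
    _ = numGraphlets k G * (α ^ 2 / 16) * (16 * (k : ℝ) ^ (4 * k)) := by ring

lemma countWeight_tilt (α μ ε : ℝ) (i : GraphletClass k) (c : GraphletClass k → ℕ) :
    countWeight (fun o => ENNReal.ofReal (tilt α μ ε i o)) c =
      ENNReal.ofReal (Real.exp (∑ j, (c j : ℝ) * tiltExponent α μ ε i j)) := by
  rw [Real.exp_sum, ENNReal.ofReal_prod_of_nonneg fun _ _ => (Real.exp_pos _).le]
  refine Finset.prod_congr rfl fun j _ => ?_
  rw [Real.exp_nat_mul, ENNReal.ofReal_pow (Real.exp_pos _).le]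
  rfl

lemma one_le_countWeight_tilt (hα : 0 < α) {i : GraphletClass k} {c : GraphletClass k → ℕ}
    (h : α * ∑ j, (c j : ℝ) ≤ ε * (c i - μ * ∑ j, (c j : ℝ))) :
    1 ≤ countWeight (fun o => ENNReal.ofReal (tilt α μ ε i o)) c := by
  rw [countWeight_tilt, sum_mul_tiltExponent, ENNReal.one_le_ofReal, Real.one_le_exp_iff]
  exact mul_nonneg (by positivity) (sub_nonneg.2 h)

lemma one_le_countWeight_of_lt_abs [Nonempty (GraphletClass k)] (hα : 0 < α) {i : GraphletClass k}
    {c : GraphletClass k → ℕ} (h : α < |estimate c i - μ|) :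
    1 ≤ countWeight (fun o => ENNReal.ofReal (tilt α μ 1 i o)) c +
      countWeight (fun o => ENNReal.ofReal (tilt α μ (-1) i o)) c := by
  by_cases h_zero : ∑ j, c j = 0
  · have hc (j : GraphletClass k) : c j = 0 := Finset.sum_eq_zero_iff.1 h_zero j (Finset.mem_univ j)
    exact (one_le_countWeight_tilt hα (by simp [hc])).trans le_self_add
  have h_pos : (0 : ℝ) < ∑ j, (c j : ℝ) := by exact_mod_cast Nat.pos_of_ne_zero h_zero
  simp only [estimate, if_neg h_zero, Nat.cast_sum] at h
  rcases lt_abs.1 h with h_above | h_below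
  · refine (one_le_countWeight_tilt hα ?_).trans le_self_add
    rw [lt_sub_iff_add_lt, lt_div_iff₀ h_pos] at h_above
    linarith
  · refine (one_le_countWeight_tilt hα ?_).trans le_add_self
    rw [neg_sub, lt_sub_comm, div_lt_iff₀ h_pos] at h_below
    linarith

lemma ofReal_one_sub_le_toOuterMeasure_estimate [Nonempty (GraphletClass k)] {X : Type*}
    (p : PMF X) (c : X → GraphletClass k → ℕ) {μ : GraphletClass k → ℝ} (hα : 0 < α) (hδ : 0 ≤ δ)
    (h : ∀ i ε, |ε| = 1 →
      expect p (fun x => countWeight (fun o => ENNReal.ofReal (tilt α (μ i) ε i o)) (c x)) ≤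
        ENNReal.ofReal (δ / (2 * Fintype.card (GraphletClass k)))) :
    ENNReal.ofReal (1 - δ) ≤ p.toOuterMeasure {x | ∀ i, |estimate (c x) i - μ i| ≤ α} := by
  set f : GraphletClass k → X → ℝ≥0∞ := fun i x =>
    countWeight (fun o => ENNReal.ofReal (tilt α (μ i) 1 i o)) (c x) +
      countWeight (fun o => ENNReal.ofReal (tilt α (μ i) (-1) i o)) (c x)
  rw [ENNReal.ofReal_sub _ hδ, ENNReal.ofReal_one]
  refine one_sub_le_toOuterMeasure _ ?_
  calc p.toOuterMeasure {x | ∀ i, |estimate (c x) i - μ i| ≤ α}ᶜ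
      ≤ expect p (fun x => ∑ i, f i x) := toOuterMeasure_le_expect _ fun x hx => by
        obtain ⟨i, hi⟩ := not_forall.1 hx
        exact (one_le_countWeight_of_lt_abs hα (not_le.1 hi)).trans
          (Finset.single_le_sum (f := (f · x)) (fun _ _ => zero_le) (Finset.mem_univ i))
    _ = ∑ i, expect p (f i) := expect_sum _ _ _
    _ ≤ ∑ _i : GraphletClass k, (ENNReal.ofReal (δ / (2 * Fintype.card (GraphletClass k))) +
          ENNReal.ofReal (δ / (2 * Fintype.card (GraphletClass k)))) :=
        Finset.sum_le_sum fun i _ => (expect_add _ _ _).trans_le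
          (add_le_add (h i 1 (by simp)) (h i (-1) (by simp)))
    _ = ENNReal.ofReal δ := by
        rw [← ENNReal.ofReal_add (by positivity) (by positivity), Finset.sum_const,
          Finset.card_univ, nsmul_eq_mul, ← ENNReal.ofReal_natCast, ← ENNReal.ofReal_mul
          (by positivity)]
        congr 1
        field_simp
        ring

end Concentration

/-! ### The sampler -/

section Sampler

variable {n k M b Q w N : ℕ} {α δ B : ℝ} {G : SimpleGraph (Fin n)}
  {order : Config → List (Sym2 (Fin n))} {write : (Fin n → ℕ) → Memory}
  {read : Memory → Fin n → ℕ}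

/-- The state from which the sampling machine makes `Q` rounds of `b` trials, given the degree
profile. -/
def sampStart (k b Q : ℕ) (d : Fin n → ℕ) : PMF (SampState n k) :=
  (rootsLaw d k b).map (.between d 0 Q (k - 1))

lemma mem_support_sampStart (hk : 2 ≤ k) {x : SampState n k}
    (hx : x ∈ (sampStart k b Q (profile G k)).support) :
    x ∈ sampStates n k b Q ∧ SampInvariant G x ∧ (sampMachine n k b).left x = Q * k := by
  obtain ⟨Ss, hSs, rfl⟩ := (PMF.mem_support_map_iff _ _ _).1 hx
  exact ⟨between_mem_sampStates (profile_le G k) hk (by simp) le_rfl hSs,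
    sampInvariant_between hk _ _ hSs, sampMachine_left_between (by omega) _ _ _ _⟩

lemma rounds_eq_zero {x : SampState n k} (h : (sampMachine n k b).left x = 0) : x.rounds = 0 := by
  by_contra h_rounds
  obtain ⟨r, hr⟩ := Nat.exists_eq_succ_of_ne_zero h_rounds
  simp [sampMachine, hr] at h

lemma expect_run_countWeight_le {L : ℕ} (K : Coding (sampStates n k b Q) L) (hk : 2 ≤ k)
    (horder : ∀ s, IsEdgeStream G (order s)) {y : Option (GraphletClass k) → ℝ≥0∞}
    (hy : y none = 1) {m : Memory} (hm : read m = profile G k) (hN : Q * k ≤ N) :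
    expect (((sampMachine n k b).toPhase K fun m => sampStart k b Q (read m)).run order N m)
        (fun t => countWeight y (K.dec t.mem).cnt) ≤
      expect (trialLaw G (profile G k) k) y ^ (Q * b) := by
  have h_invariant := sampMachine_isInvariant hk b G
  have h_closed := sampMachine_closed (n := n) hk b Q
  have h_potential : ∀ t ∈ (((sampMachine n k b).toPhase K
      fun m => sampStart k b Q (read m)).run order N m).support,
      countWeight y (K.dec t.mem).cnt = sampPotential G b y (K.dec t.mem) := by
    intro t ht
    obtain ⟨x, hx, -, h_left, rfl⟩ := Machine.mem_support_run_toPhase h_closed h_invariant horder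
      (fun x hx => mem_support_sampStart hk (by rwa [hm] at hx)) hN ht
    rw [K.dec_enc x hx, sampPotential, rounds_eq_zero h_left, mul_one]
  rw [expect_congr _ h_potential]
  refine (Machine.expect_run_toPhase_le h_closed h_invariant horder
    (fun x hx h_left l hl => (expect_pass_sampPotential hl hy hx h_left).le) N
    fun x hx => ?_).trans_eq ?_
  · rw [hm] at hx
    exact ⟨(mem_support_sampStart hk hx).1, (mem_support_sampStart hk hx).2.1⟩
  · rw [hm, sampStart, expect_map, expect_sampPotential_roots, ← pow_mul, mul_comm b]
    simp [countWeight]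

lemma ofReal_exp_neg_pow_le {s a : ℝ} {T : ℕ} (ha : 0 < a) (h : Real.log a⁻¹ ≤ s * T) :
    ENNReal.ofReal (Real.exp (-s)) ^ T ≤ ENNReal.ofReal a := by
  rw [← ENNReal.ofReal_pow (Real.exp_pos _).le, ← Real.exp_nat_mul]
  refine ENNReal.ofReal_le_ofReal ((Real.le_log_iff_exp_le ha).1 ?_)
  rw [Real.log_inv] at h
  linarith

lemma hasSampler_of_trials (hk : 2 ≤ k) (hkn : k ≤ n) (hb : 0 < b) (hw : Q * b < 2 ^ w)
    (hα : 0 < α) (hα1 : α < 1) (hδ : 0 < δ)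
    (hT : Real.log (2 * Fintype.card (GraphletClass k) / δ) * (16 * (k : ℝ) ^ (4 * k)) ≤
      α ^ 2 * (Q * b : ℕ)) (hB : (Q * k : ℕ) ≤ B)
    (hM : n * wordSize n + (Fintype.card (GraphletClass k) * w + (w +
      (wordSize n + b * (k * wordSize n + k * k + (2 * wordSize n + wordSize n))))) ≤
        M * wordSize n)
    (hread : ∀ d, (∀ v, d v ≤ n) → read (write d) = d)
    (hwrite : ∀ d, (write d).length ≤ M * wordSize n) : HasSampler n k M α δ B write := by
  have := nonempty_graphletClass (k := k) (by omega)
  have : Nonempty (SampState n k) := ⟨⟨0, 0, 0, 0, []⟩⟩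
  obtain ⟨K⟩ := (sampStates_fits hkn hb hw).nonempty_coding
  refine ⟨(sampMachine n k b).toPhase K fun m => sampStart k b Q (read m),
    fun m => estimate (K.dec m).cnt, Q * k, fun N hN G order horder => ?_⟩
  have hm := hread _ (profile_le G k)
  refine ⟨fun t ht => ?_, fun hG => ?_⟩
  · obtain ⟨y, hy, -, h_left, rfl⟩ := Machine.mem_support_run_toPhase (sampMachine_closed hk b Q)
      (sampMachine_isInvariant hk b G) horder
      (fun x hx => mem_support_sampStart hk (by rwa [hm] at hx)) hN ht
    exact ⟨(Machine.halt_toPhase hy).2 h_left, estimate_mem_stdSimplex _, hB,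
      max_le (hwrite _) hM⟩
  · refine ofReal_one_sub_le_toOuterMeasure_estimate _ _ hα hδ.le fun i ε hε => ?_
    have : (0 : ℝ) < Fintype.card (GraphletClass k) := by exact_mod_cast Fintype.card_pos
    have : (0 : ℝ) < k := by exact_mod_cast (by omega : 0 < k)
    refine (expect_run_countWeight_le K hk horder (by simp [tilt]) hm hN).trans ?_
    refine (pow_le_pow_left' (expect_trialLaw_tilt_le hk hα hα1 hε hG i) _).trans
      (ofReal_exp_neg_pow_le (by positivity) ?_)
    rw [inv_div, div_mul_eq_mul_div, le_div_iff₀ (by positivity)]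
    exact hT

end Sampler

/-! ### Choice of the parameters -/

section Parameters

variable {n k M b Q : ℕ} {α δ : ℝ}

lemma wordSize_pos (n : ℕ) : 0 < wordSize n := Nat.succ_pos _

/-- The number of passes granted to the sampling phase. -/
def passBudget (C k M : ℕ) (α δ : ℝ) : ℝ :=
  C * (k + (k : ℝ) ^ (C * k) / (α ^ 4 * M) * Real.log (2 / δ))

/-- A number of trials that suffices for accuracy `α` with probability `1 - δ`. -/
def trialBudget (k : ℕ) (α δ : ℝ) : ℝ := (k : ℝ) ^ (8 * k) * (Real.log (2 / δ) / α ^ 4)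

lemma passBudget_eq (C k M : ℕ) (α δ : ℝ) : passBudget C k M α δ =
    C * k + C * ((k : ℝ) ^ (C * k) * (Real.log (2 / δ) / α ^ 4 / M)) := by
  simp only [passBudget, div_eq_mul_inv, mul_inv]
  ring

lemma log_two_le_log_two_div (hδ : δ ∈ Set.Ioo (0 : ℝ) 1) : Real.log 2 ≤ Real.log (2 / δ) :=
  Real.log_le_log two_pos (le_div_self two_pos.le hδ.1 hδ.2.le)

lemma log_two_div_pos (hδ : δ ∈ Set.Ioo (0 : ℝ) 1) : 0 < Real.log (2 / δ) :=
  (Real.log_pos one_lt_two).trans_le (log_two_le_log_two_div hδ)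

lemma le_two_mul_card_graphletClass (hk : 2 ≤ k) : k ≤ 2 * Fintype.card (GraphletClass k) := by
  have := sub_one_le_card_graphletClass k
  omega

lemma storeAllBits_le {m w : ℕ} (hw : 0 < w) (hm : 0 < m) (hn : 256 * (n + k * m) ≤ M)
    (hM : 4 * n ^ 2 ≤ M) : k * w + m * (k * w) + n * n ≤ M * w := by
  have h_km : k ≤ k * m := Nat.le_mul_of_pos_right _ hm
  have h_square : n * n ≤ n * n * w := Nat.le_mul_of_pos_right _ hw
  calc k * w + m * (k * w) + n * n ≤ k * w + m * (k * w) + n * n * w := by gcongr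
    _ = (k + k * m + n ^ 2) * w := by ring
    _ ≤ M * w := by gcongr; omega

lemma hasSampler_of_square_le (hn : 1 ≤ n) (hk : 2 ≤ k) (hα : 0 ≤ α)
    (hδ : δ ∈ Set.Ioo (0 : ℝ) 1) (hM : 256 * (n + k * Fintype.card (GraphletClass k)) ≤ M)
    (h_square : 4 * n ^ 2 ≤ M) {write : (Fin n → ℕ) → Memory}
    (hwrite : ∀ d, (write d).length ≤ M * wordSize n) :
    HasSampler n k M α δ (passBudget 256 k M α δ) write := by
  have hm := le_two_mul_card_graphletClass hk
  refine hasSampler_of_cover (κ := n) (Q := 1) (ws := fun _ => Finset.univ) (by omega) hα hδ.1.le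
    (fun _ => by simp) (Nat.one_le_pow _ _ hn) (fun S _ => ⟨0, one_pos, Finset.subset_univ S⟩) ?_
    (storeAllBits_le (wordSize_pos n) (by omega) hM h_square) hwrite
  have h_log := (log_two_div_pos hδ).le
  have h_budget : (0 : ℝ) ≤ (k : ℝ) ^ (256 * k) * (Real.log (2 / δ) / α ^ 4 / M) := by positivity
  have hk_cast : (2 : ℝ) ≤ k := by exact_mod_cast hk
  rw [passBudget_eq]
  push_cast
  linarith

lemma exists_enum_powersetCard (n k : ℕ) : ∃ W : ℕ → Finset (Fin n),
    (∀ j, #(W j) ≤ k) ∧ ∀ S : Finset (Fin n), #S = k → ∃ j < n.choose k, S ⊆ W j := by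
  set l := (Finset.powersetCard k (Finset.univ : Finset (Fin n))).toList with hl
  have h_length : l.length = n.choose k := by simp [hl]
  have h_mem (S : Finset (Fin n)) : S ∈ l ↔ #S = k := by simp [hl, Finset.mem_powersetCard]
  refine ⟨fun j => l.getD j ∅, fun j => ?_, fun S hS => ?_⟩
  · rcases lt_or_ge j l.length with hj | hj
    · simp only [List.getD_eq_getElem _ _ hj]
      exact ((h_mem _).1 (List.getElem_mem hj)).le
    · simp only [List.getD_eq_default _ _ hj]
      exact Nat.zero_le k
  · obtain ⟨j, hj, rfl⟩ := List.getElem_of_mem ((h_mem S).2 hS)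
    exact ⟨j, h_length ▸ hj, (List.getD_eq_getElem _ _ hj).ge⟩

lemma storeSubgraphBits_le {m w : ℕ} (hw : 0 < w) (hkm : k ≤ 2 * m)
    (hM : 256 * (k * m) ≤ M) : k * w + m * (k * w) + k * k ≤ M * w := by
  rcases k.eq_zero_or_pos with rfl | hk
  · simp
  have h_km : k ≤ k * m := Nat.le_mul_of_pos_right _ (by omega)
  have h_square : k * k ≤ 2 * (k * m) := (Nat.mul_le_mul_left k hkm).trans_eq (by ring)
  have h_square' : k * k ≤ k * k * w := Nat.le_mul_of_pos_right _ hw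
  calc k * w + m * (k * w) + k * k ≤ k * w + m * (k * w) + k * k * w := by gcongr
    _ = (k + k * m + k * k) * w := by ring
    _ ≤ M * w := by gcongr; omega

lemma pow_le_passBudget (hk : 1 ≤ k) (hM : 0 < M) (h_square : M ≤ 4 * n ^ 2)
    (h_log : (n : ℝ) ^ (k + 2) ≤ Real.log (2 / δ) / α ^ 4) :
    (n : ℝ) ^ k ≤ passBudget 256 k M α δ := by
  have hM_pos : (0 : ℝ) < M := by exact_mod_cast hM
  have h_square' : (M : ℝ) ≤ 4 * (n : ℝ) ^ 2 := by exact_mod_cast h_square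
  have h_pow : (n : ℝ) ^ k ≤ 4 * (Real.log (2 / δ) / α ^ 4 / M) := by
    rw [← mul_div_assoc, le_div_iff₀ hM_pos]
    calc (n : ℝ) ^ k * M ≤ (n : ℝ) ^ k * (4 * (n : ℝ) ^ 2) := by gcongr
      _ = 4 * (n : ℝ) ^ (k + 2) := by ring
      _ ≤ 4 * (Real.log (2 / δ) / α ^ 4) := by gcongr
  have h_nonneg : 0 ≤ Real.log (2 / δ) / α ^ 4 / M := by
    have : (0 : ℝ) ≤ (n : ℝ) ^ k := by positivity
    linarith
  have h_budget := le_mul_of_one_le_left h_nonneg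
    (one_le_pow₀ (n := 256 * k) (by exact_mod_cast hk : (1 : ℝ) ≤ k))
  have : (0 : ℝ) ≤ k := k.cast_nonneg
  rw [passBudget_eq]
  push_cast
  linarith

lemma hasSampler_of_pow_le (hk : 2 ≤ k) (hα : 0 ≤ α) (hδ : 0 ≤ δ)
    (hM : 256 * (n + k * Fintype.card (GraphletClass k)) ≤ M) (h_square : M ≤ 4 * n ^ 2)
    (h_log : (n : ℝ) ^ (k + 2) ≤ Real.log (2 / δ) / α ^ 4) {write : (Fin n → ℕ) → Memory}
    (hwrite : ∀ d, (write d).length ≤ M * wordSize n) :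
    HasSampler n k M α δ (passBudget 256 k M α δ) write := by
  have hm := le_two_mul_card_graphletClass hk
  have h_km : 0 < k * Fintype.card (GraphletClass k) := Nat.mul_pos (by omega) (by omega)
  obtain ⟨W, hW, h_cover⟩ := exists_enum_powersetCard n k
  refine hasSampler_of_cover (by omega) hα hδ hW (Nat.choose_le_pow n k) h_cover ?_
    (storeSubgraphBits_le (wordSize_pos n) hm (by omega)) hwrite
  calc ((n.choose k : ℕ) : ℝ) ≤ (n : ℝ) ^ k := by exact_mod_cast Nat.choose_le_pow n k
    _ ≤ passBudget 256 k M α δ := pow_le_passBudget (by omega) (by omega) h_square h_log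

lemma log_card_graphletClass_le (hk : 0 < k) (hδ : δ ∈ Set.Ioo (0 : ℝ) 1) :
    Real.log (2 * Fintype.card (GraphletClass k) / δ) ≤ (k * k + 1) * Real.log (2 / δ) := by
  have := nonempty_graphletClass hk
  have hm : (0 : ℝ) < Fintype.card (GraphletClass k) := by exact_mod_cast Fintype.card_pos
  have h_card : Real.log (Fintype.card (GraphletClass k)) ≤ (k * k) * Real.log 2 := by
    have h_pow : (Fintype.card (GraphletClass k) : ℝ) ≤ 2 ^ (k * k) := by
      exact_mod_cast card_graphletClass_le k
    simpa using Real.log_le_log hm h_pow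
  have h_eq : 2 * (Fintype.card (GraphletClass k) : ℝ) / δ =
    Fintype.card (GraphletClass k) * (2 / δ) := by ring
  calc Real.log (2 * Fintype.card (GraphletClass k) / δ)
      = Real.log (Fintype.card (GraphletClass k)) + Real.log (2 / δ) := by
        rw [h_eq, Real.log_mul hm.ne' (div_pos two_pos hδ.1).ne']
    _ ≤ (k * k) * Real.log (2 / δ) + Real.log (2 / δ) := by
        gcongr
        exact h_card.trans
          (mul_le_mul_of_nonneg_left (log_two_le_log_two_div hδ) (by positivity))
    _ = (k * k + 1) * Real.log (2 / δ) := by ring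

lemma square_add_one_mul_pow_le (hk : 3 ≤ k) :
    ((k : ℝ) * k + 1) * (16 * (k : ℝ) ^ (4 * k)) ≤ (k : ℝ) ^ (8 * k) := by
  have hk_cast : (3 : ℝ) ≤ k := by exact_mod_cast hk
  have h_cube : (k : ℝ) * k + 1 ≤ (k : ℝ) ^ 3 := by nlinarith [sq_nonneg (k : ℝ)]
  have h_cube' : (16 : ℝ) ≤ (k : ℝ) ^ 3 :=
    (by norm_num : (16 : ℝ) ≤ 3 ^ 3).trans (by gcongr)
  calc ((k : ℝ) * k + 1) * (16 * (k : ℝ) ^ (4 * k))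
      ≤ (k : ℝ) ^ 3 * ((k : ℝ) ^ 3 * (k : ℝ) ^ (4 * k)) := by gcongr
    _ = (k : ℝ) ^ (4 * k + 6) := by ring
    _ ≤ (k : ℝ) ^ (8 * k) := pow_le_pow_right₀ (by linarith) (by omega)

lemma log_mul_le_trialBudget (hk : 3 ≤ k) (hα : α ∈ Set.Ioo (0 : ℝ) 1)
    (hδ : δ ∈ Set.Ioo (0 : ℝ) 1) :
    Real.log (2 * Fintype.card (GraphletClass k) / δ) * (16 * (k : ℝ) ^ (4 * k)) ≤
      α ^ 2 * trialBudget k α δ := by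
  have h_log := log_two_div_pos hδ
  have h_alpha : Real.log (2 / δ) ≤ α ^ 2 * (Real.log (2 / δ) / α ^ 4) := by
    rw [← mul_div_assoc, le_div_iff₀ (pow_pos hα.1 4), mul_comm]
    exact mul_le_mul_of_nonneg_right
      (pow_le_pow_of_le_one hα.1.le hα.2.le (by norm_num)) h_log.le
  calc Real.log (2 * Fintype.card (GraphletClass k) / δ) * (16 * (k : ℝ) ^ (4 * k))
      ≤ (k * k + 1) * Real.log (2 / δ) * (16 * (k : ℝ) ^ (4 * k)) := by
        gcongr
        exact log_card_graphletClass_le (by omega) hδ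
    _ = (k * k + 1) * (16 * (k : ℝ) ^ (4 * k)) * Real.log (2 / δ) := by ring
    _ ≤ (k : ℝ) ^ (8 * k) * (α ^ 2 * (Real.log (2 / δ) / α ^ 4)) := by
        gcongr
        exact square_add_one_mul_pow_le hk
    _ = α ^ 2 * trialBudget k α δ := by rw [trialBudget]; ring

lemma exists_mul_le_le_two_mul {a M : ℕ} (ha : 0 < a) (h : a ≤ M) :
    ∃ b, 0 < b ∧ b * a ≤ M ∧ M ≤ 2 * (b * a) := by
  have h_pos : 0 < M / a := Nat.div_pos h ha
  refine ⟨M / a, h_pos, Nat.div_mul_le_self M a, ?_⟩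
  have h_lt : M < M / a * a + a := (Nat.lt_div_mul_add ha)
  have h_le : a ≤ M / a * a := Nat.le_mul_of_pos_left a h_pos
  omega

lemma exists_nat_mul_mem_Icc {x b : ℝ} (hx : 0 ≤ x) (hb : 0 < b) :
    ∃ Q : ℕ, Q * b ∈ Set.Icc x (x + b) := by
  refine ⟨⌈x / b⌉₊, (div_le_iff₀ hb).1 (Nat.le_ceil _), ?_⟩
  calc (⌈x / b⌉₊ : ℝ) * b ≤ (x / b + 1) * b := by
        gcongr
        exact (Nat.ceil_lt_add_one (by positivity)).le
    _ = x + b := by field_simp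

lemma trialBudget_add_le_pow (hk : 3 ≤ k) (hkn : k ≤ n) (hδ : δ ∈ Set.Ioo (0 : ℝ) 1)
    (hb : b ≤ 4 * n ^ 2)
    (h_log : Real.log (2 / δ) / α ^ 4 ≤ (n : ℝ) ^ (k + 2)) :
    trialBudget k α δ + b ≤ (n : ℝ) ^ (10 * k) := by
  have hn : (3 : ℝ) ≤ n := by exact_mod_cast hk.trans hkn
  have hb_cast : (b : ℝ) ≤ 4 * (n : ℝ) ^ 2 := by exact_mod_cast hb
  have := log_two_div_pos hδ
  have h_trials : trialBudget k α δ ≤ (n : ℝ) ^ (9 * k + 2) :=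
    calc trialBudget k α δ ≤ (n : ℝ) ^ (8 * k) * (n : ℝ) ^ (k + 2) := by
          unfold trialBudget
          gcongr
      _ = (n : ℝ) ^ (9 * k + 2) := by ring
  have h_square : 4 * (n : ℝ) ^ 2 ≤ 2 * (n : ℝ) ^ (9 * k + 2) :=
    calc 4 * (n : ℝ) ^ 2 ≤ 2 * (n : ℝ) ^ 3 := by nlinarith [sq_nonneg (n : ℝ)]
      _ ≤ 2 * (n : ℝ) ^ (9 * k + 2) := by gcongr <;> linarith
  calc trialBudget k α δ + b ≤ 3 * (n : ℝ) ^ (9 * k + 2) := by linarith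
    _ ≤ n * (n : ℝ) ^ (9 * k + 2) := by gcongr
    _ = (n : ℝ) ^ (9 * k + 3) := by ring
    _ ≤ (n : ℝ) ^ (10 * k) := pow_le_pow_right₀ (by linarith) (by omega)

lemma mul_le_passBudget (hk : 1 ≤ k) (hM : 0 < M) (hb : 0 < b) (hδ : δ ∈ Set.Ioo (0 : ℝ) 1)
    (hMb : M ≤ 128 * (k * k) * b) (hQ : (Q : ℝ) * b ≤ trialBudget k α δ + b) :
    (Q * k : ℕ) ≤ passBudget 256 k M α δ := by
  set L := Real.log (2 / δ) / α ^ 4 with hL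
  have hL_nonneg : 0 ≤ L := div_nonneg (log_two_div_pos hδ).le (by positivity)
  have hk_cast : (1 : ℝ) ≤ k := by exact_mod_cast hk
  have hb_pos : (0 : ℝ) < b := by exact_mod_cast hb
  have hM_pos : (0 : ℝ) < M := by exact_mod_cast hM
  have h_inv : (1 : ℝ) / b ≤ 128 * (k * k) / M := by
    rw [div_le_div_iff₀ hb_pos hM_pos, one_mul]
    exact_mod_cast hMb
  have h_rounds : (Q : ℝ) ≤ trialBudget k α δ * (1 / b) + 1 := by
    rw [← div_eq_mul_one_div, ← sub_le_iff_le_add, le_div_iff₀ hb_pos]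
    linarith
  have h_nonneg : 0 ≤ (k : ℝ) ^ (256 * k) * (L / M) := by positivity
  rw [passBudget_eq, ← hL, Nat.cast_mul]
  calc (Q : ℝ) * k ≤ (trialBudget k α δ * (1 / b) + 1) * k := by gcongr
    _ ≤ ((k : ℝ) ^ (8 * k) * L * (128 * (k * k) / M) + 1) * k := by
        rw [trialBudget]
        gcongr
    _ = k + 128 * ((k : ℝ) ^ (8 * k + 3) * (L / M)) := by ring
    _ ≤ k + 128 * ((k : ℝ) ^ (256 * k) * (L / M)) := by
        gcongr
        omega
    _ ≤ (256 : ℕ) * k + (256 : ℕ) * ((k : ℝ) ^ (256 * k) * (L / M)) := by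
        push_cast
        linarith

lemma sampStatesBits_le {m w : ℕ} (hw : 0 < w) (hk : 2 ≤ k) (hm : 0 < m)
    (hM : 256 * (n + k * m) ≤ M) (hb : b * (64 * (k * k)) ≤ M) :
    n * w + (m * (10 * k * w) + (10 * k * w + (w + b * (k * w + k * k + (2 * w + w))))) ≤
      M * w := by
  have h_km : k ≤ k * m := Nat.le_mul_of_pos_right _ hm
  have h_trial : k * w + k * k + (2 * w + w) ≤ 3 * (k * k) * w :=
    calc k * w + k * k + (2 * w + w) ≤ k * k * w + k * k * w + k * k * w := by
          have h_four : 2 * 2 ≤ k * k := Nat.mul_le_mul hk hk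
          have h_words : 3 * w ≤ k * k * w := Nat.mul_le_mul_right w (by omega)
          have h_square : k * k ≤ k * k * w := Nat.le_mul_of_pos_right _ hw
          have h_vertices : k * w ≤ k * k * w := Nat.mul_le_mul_right w (Nat.le_mul_self k)
          linarith
      _ = 3 * (k * k) * w := by ring
  calc n * w + (m * (10 * k * w) + (10 * k * w + (w + b * (k * w + k * k + (2 * w + w)))))
      ≤ n * w + (m * (10 * k * w) + (10 * k * w + (w + b * (3 * (k * k) * w)))) := by gcongr
    _ = (n + (10 * (k * m) + (10 * k + (1 + 3 * (b * (k * k)))))) * w := by ring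
    _ ≤ M * w := by
        gcongr
        linarith

lemma hasSampler_of_lt_pow (hk : 3 ≤ k) (hα : α ∈ Set.Ioo (0 : ℝ) 1)
    (hδ : δ ∈ Set.Ioo (0 : ℝ) 1) (hM : 256 * (n + k * Fintype.card (GraphletClass k)) ≤ M)
    (h_square : M < 4 * n ^ 2) (h_log : Real.log (2 / δ) / α ^ 4 ≤ (n : ℝ) ^ (k + 2))
    {write : (Fin n → ℕ) → Memory} {read : Memory → Fin n → ℕ}
    (hread : ∀ d, (∀ v, d v ≤ n) → read (write d) = d)
    (hwrite : ∀ d, (write d).length ≤ M * wordSize n) :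
    HasSampler n k M α δ (passBudget 256 k M α δ) write := by
  have hm := le_two_mul_card_graphletClass (k := k) (by omega)
  have hkk : k * k ≤ 2 * (k * Fintype.card (GraphletClass k)) :=
    (Nat.mul_le_mul_left k hm).trans_eq (by ring)
  have hkn : k ≤ n := by
    by_contra! h
    nlinarith
  obtain ⟨b, hb, hbM, hMb⟩ := exists_mul_le_le_two_mul (a := 64 * (k * k)) (M := M)
    (by positivity) (by omega)
  have hb_le : b ≤ M := (Nat.le_mul_of_pos_right b (by positivity)).trans hbM
  have h_log_nonneg := (log_two_div_pos hδ).le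
  obtain ⟨Q, hQ, hQ_le⟩ := exists_nat_mul_mem_Icc (x := trialBudget k α δ) (b := b)
    (by unfold trialBudget; positivity) (by exact_mod_cast hb)
  have h_counter : Q * b ≤ n ^ (10 * k) := by
    exact_mod_cast hQ_le.trans (trialBudget_add_le_pow hk hkn hδ (hb_le.trans h_square.le) h_log)
  refine hasSampler_of_trials (by omega) hkn hb
    (h_counter.trans_lt (pow_lt_two_pow n (by omega : 0 < 10 * k))) hα.1 hα.2 hδ.1
    ((log_mul_le_trialBudget hk hα hδ).trans ?_)
    (mul_le_passBudget (by omega) (by omega) hb hδ (by linarith) hQ_le)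
    (sampStatesBits_le (wordSize_pos n) (by omega) (by omega) hM hbM) hread hwrite
  push_cast
  have := hα.1
  gcongr

/-- If the memory can hold the graph, or if there are enough passes to look at all sets of `k`
vertices one after the other, the graphlets are counted exactly. Otherwise the number of trials is
polynomial in `n` for fixed `k`, so that a counter takes only `O(k)` words. -/
lemma exists_hasSampler (hn : 1 ≤ n) (hk : 3 ≤ k) (hα : α ∈ Set.Ioo (0 : ℝ) 1)
    (hδ : δ ∈ Set.Ioo (0 : ℝ) 1) (hM : 256 * (n + k * Fintype.card (GraphletClass k)) ≤ M)
    {write : (Fin n → ℕ) → Memory} {read : Memory → Fin n → ℕ}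
    (hread : ∀ d, (∀ v, d v ≤ n) → read (write d) = d)
    (hwrite : ∀ d, (write d).length ≤ M * wordSize n) :
    HasSampler n k M α δ (passBudget 256 k M α δ) write := by
  rcases le_or_gt (4 * n ^ 2) M with h_square | h_square
  · exact hasSampler_of_square_le hn (by omega) hα.1.le hδ hM h_square hwrite
  rcases le_total ((n : ℝ) ^ (k + 2)) (Real.log (2 / δ) / α ^ 4) with h_log | h_log
  · exact hasSampler_of_pow_le (by omega) hα.1.le hδ.1.le hM h_square.le h_log hwrite
  · exact hasSampler_of_lt_pow hk hα hδ hM h_square h_log hread hwrite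

lemma one_le_log_add_two (hn : 1 ≤ n) : 1 ≤ Real.log (n + 2) := by
  have hn_cast : (1 : ℝ) ≤ n := by exact_mod_cast hn
  rw [Real.le_log_iff_exp_le (by positivity)]
  linarith [Real.exp_one_lt_three]

lemma wordSize_le_log (hn : 1 ≤ n) : (wordSize n : ℝ) ≤ 3 * Real.log (n + 2) := by
  have h_pow : (2 : ℝ) ^ Nat.log 2 n ≤ n + 2 := by
    exact_mod_cast (Nat.pow_log_le_self 2 (by omega)).trans (Nat.le_add_right n 2)
  have h_log : (Nat.log 2 n : ℝ) * Real.log 2 ≤ Real.log (n + 2) := by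
    simpa using Real.log_le_log (by positivity) h_pow
  have h_half : (Nat.log 2 n : ℝ) * (1 / 2) ≤ Nat.log 2 n * Real.log 2 := by
    gcongr
    linarith [Real.log_two_gt_d9]
  have h_one := one_le_log_add_two hn
  rw [wordSize]
  push_cast
  linarith

lemma preprocessingBits_le {c : ℝ} (hn : 1 ≤ n) (hc : 0 < c) :
    ((3 * (n * wordSize n) + 1 : ℕ) : ℝ) ≤
      (256 : ℕ) * (n : ℝ) ^ (1 + c) * Real.log (n + 2) ^ 256 := by
  have h_pos : 0 < n * wordSize n := Nat.mul_pos hn (wordSize_pos n)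
  have h_pow : (n : ℝ) ≤ (n : ℝ) ^ (1 + c) :=
    Real.self_le_rpow_of_one_le (by exact_mod_cast hn) (by linarith)
  have h_one := one_le_log_add_two hn
  have h_log : (wordSize n : ℝ) ≤ 3 * Real.log (n + 2) ^ 256 :=
    (wordSize_le_log hn).trans (by gcongr; exact le_self_pow₀ h_one (by norm_num))
  calc ((3 * (n * wordSize n) + 1 : ℕ) : ℝ) ≤ 4 * (n * wordSize n) := by
        exact_mod_cast (by omega : 3 * (n * wordSize n) + 1 ≤ 4 * (n * wordSize n))
    _ ≤ 4 * ((n : ℝ) ^ (1 + c) * (3 * Real.log (n + 2) ^ 256)) := by gcongr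
    _ = 12 * ((n : ℝ) ^ (1 + c) * Real.log (n + 2) ^ 256) := by ring
    _ ≤ 256 * ((n : ℝ) ^ (1 + c) * Real.log (n + 2) ^ 256) := by gcongr; norm_num
    _ = (256 : ℕ) * (n : ℝ) ^ (1 + c) * Real.log (n + 2) ^ 256 := by push_cast; ring

end Parameters

/-! ### The two phases together -/

section TwoPhases

variable {n k M : ℕ} {c α δ : ℝ}

lemma TwoPhaseAlg.mem_support_run {A : TwoPhaseAlg n k} {order₁ : Config → List (Sym2 (Fin n))}
    {order₂ : Config → Config → List (Sym2 (Fin n))} {N : ℕ} {s : Config × Config} :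
    s ∈ (A.run order₁ order₂ N).support ↔ s.1 ∈ (A.preprocessing.run order₁ N []).support ∧
      s.2 ∈ (A.sampling.run (order₂ s.1) N s.1.mem).support := by
  rcases s with ⟨s₁, s₂⟩
  simp [TwoPhaseAlg.run, and_comm]

lemma TwoPhaseAlg.le_toOuterMeasure_run {A : TwoPhaseAlg n k}
    {order₁ : Config → List (Sym2 (Fin n))} {order₂ : Config → Config → List (Sym2 (Fin n))}
    {N : ℕ} {T : Set Config} {a : ℝ≥0∞}
    (h : ∀ s ∈ (A.preprocessing.run order₁ N []).support,
      a ≤ (A.sampling.run (order₂ s) N s.mem).toOuterMeasure T) :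
    a ≤ (A.run order₁ order₂ N).toOuterMeasure {s | s.2 ∈ T} := by
  rw [TwoPhaseAlg.run, PMF.toOuterMeasure_bind_apply]
  refine le_expect _ fun s hs => ?_
  rw [PMF.toOuterMeasure_map_apply]
  exact h s hs

/-- The guarantees of a two-phase algorithm for given parameters, with the constant `C`. -/
def Meets (C M : ℕ) (c α δ : ℝ) (A : TwoPhaseAlg n k) : Prop :=
  ∃ N : ℕ, ∀ (G : SimpleGraph (Fin n)) (order₁ : Config → List (Sym2 (Fin n)))
    (order₂ : Config → Config → List (Sym2 (Fin n))),
    (∀ s, IsEdgeStream G (order₁ s)) → (∀ s t, IsEdgeStream G (order₂ s t)) →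
    (∀ s ∈ (A.run order₁ order₂ N).support,
      A.preprocessing.halt s.1.mem = true ∧ A.sampling.halt s.2.mem = true ∧
      A.output s.2.mem ∈ stdSimplex ℝ (GraphletClass k)) ∧
    ENNReal.ofReal (1 - 1 / (n : ℝ)) ≤
      (A.run order₁ order₂ N).toOuterMeasure
        {s | (s.1.passes : ℝ) ≤ C * (1 + 1 / c) ∧
          (s.1.peak : ℝ) ≤ C * (n : ℝ) ^ (1 + c) * Real.log (n + 2) ^ C} ∧
    (∀ s ∈ (A.run order₁ order₂ N).support,
      (s.2.passes : ℝ) ≤ passBudget C k M α δ ∧ s.2.peak ≤ M * wordSize n) ∧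
    (0 < numGraphlets k G →
      ENNReal.ofReal (1 - δ) ≤
        (A.run order₁ order₂ N).toOuterMeasure
          {s | ∀ i : GraphletClass k, |A.output s.2.mem i - graphletDist G i| ≤ α})

lemma preprocessingBits_le_mul_wordSize (hn : 1 ≤ n)
    (hM : 256 * (n + k * Fintype.card (GraphletClass k)) ≤ M) :
    3 * (n * wordSize n) + 1 ≤ M * wordSize n := by
  have h_pos : 0 < n * wordSize n := Nat.mul_pos hn (wordSize_pos n)
  calc 3 * (n * wordSize n) + 1 ≤ 4 * n * wordSize n := by linarith
    _ ≤ M * wordSize n := by gcongr; omega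

lemma exists_meets (hn : 1 ≤ n) (hk : 3 ≤ k) (hc : 0 < c) (hα : α ∈ Set.Ioo (0 : ℝ) 1)
    (hδ : δ ∈ Set.Ioo (0 : ℝ) 1) (hM : 256 * (n + k * Fintype.card (GraphletClass k)) ≤ M) :
    ∃ A : TwoPhaseAlg n k, Meets 256 M c α δ A := by
  obtain ⟨P, K, hP⟩ := exists_preprocessing n k
  obtain ⟨S, out, N₀, hS⟩ := exists_hasSampler hn hk hα hδ hM K.dec_enc fun d =>
    (K.length_enc d).trans_le (preprocessingBits_le_mul_wordSize hn hM)
  set N := max 1 N₀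
  refine ⟨⟨P, S, out⟩, N, fun G order₁ order₂ h₁ h₂ => ?_⟩
  have h_pre := hP G order₁ h₁ N (le_max_left _ _)
  have h_mem {s₁ : Config} (hs₁ : s₁ ∈ (P.run order₁ N []).support) :
      s₁.mem = K.enc (profile G k) := by rw [(h_pre s₁ hs₁).2]
  have h_samp (s₁ : Config) := hS N (le_max_right _ _) G (order₂ s₁) (h₂ s₁)
  have h_samp' {s : Config × Config}
      (hs : s ∈ (TwoPhaseAlg.run ⟨P, S, out⟩ order₁ order₂ N).support) :=
    (h_samp s.1).1 s.2
      (h_mem (TwoPhaseAlg.mem_support_run.1 hs).1 ▸ (TwoPhaseAlg.mem_support_run.1 hs).2)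
  refine ⟨fun s hs => ?_, ?_, fun s hs => (h_samp' hs).2.2, fun hG => ?_⟩
  · exact ⟨(h_pre s.1 (TwoPhaseAlg.mem_support_run.1 hs).1).1, (h_samp' hs).1, (h_samp' hs).2.1⟩
  · rw [(PMF.toOuterMeasure_apply_eq_one_iff _ _).2]
    · exact ENNReal.ofReal_le_one.2 (sub_le_self 1 (by positivity))
    · intro s hs
      have h_eq := (h_pre s.1 (TwoPhaseAlg.mem_support_run.1 hs).1).2
      refine ⟨?_, by simpa only [h_eq] using preprocessingBits_le hn hc⟩
      have : 0 ≤ 1 / c := by positivity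
      rw [h_eq]
      push_cast
      linarith
  · refine TwoPhaseAlg.le_toOuterMeasure_run
      (T := {t | ∀ i, |out t.mem i - graphletDist G i| ≤ α}) fun s hs => ?_
    rw [h_mem hs]
    exact (h_samp s).2 hG

/-- The phase that never makes a pass. -/
def Phase.idle (n : ℕ) : Phase n where
  start := PMF.pure
  halt _ := true
  step m _ := PMF.pure m
  endPass := PMF.pure

instance : Nonempty (TwoPhaseAlg n k) := ⟨⟨Phase.idle n, Phase.idle n, fun _ _ => 0⟩⟩

end TwoPhases

end GraphletStream

end

open GraphletStream in
theorem theorem1 :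
    ∃ (C : ℕ) (alg : (n k M : ℕ) → (c α δ : ℝ) → TwoPhaseAlg n k),
      ∀ (n k M : ℕ) (c α δ : ℝ), 1 ≤ n → 3 ≤ k → 0 < c → α ∈ Set.Ioo (0 : ℝ) 1 →
        δ ∈ Set.Ioo (0 : ℝ) 1 → C * (n + k * Fintype.card (GraphletClass k)) ≤ M →
      ∃ N : ℕ, ∀ (G : SimpleGraph (Fin n)) (order₁ : Config → List (Sym2 (Fin n)))
        (order₂ : Config → Config → List (Sym2 (Fin n))),
        (∀ s, IsEdgeStream G (order₁ s)) → (∀ s t, IsEdgeStream G (order₂ s t)) →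
        -- the algorithm always terminates and returns a probability distribution
        (∀ s ∈ ((alg n k M c α δ).run order₁ order₂ N).support,
          (alg n k M c α δ).preprocessing.halt s.1.mem = true ∧
          (alg n k M c α δ).sampling.halt s.2.mem = true ∧
          (alg n k M c α δ).output s.2.mem ∈ stdSimplex ℝ (GraphletClass k)) ∧
        -- passes and bits of the preprocessing phase
        ENNReal.ofReal (1 - 1 / (n : ℝ)) ≤
          ((alg n k M c α δ).run order₁ order₂ N).toOuterMeasure
            {s | (s.1.passes : ℝ) ≤ C * (1 + 1 / c) ∧
              (s.1.peak : ℝ) ≤ C * (n : ℝ) ^ (1 + c) * Real.log (n + 2) ^ C} ∧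
        -- passes and bits of the sampling phase
        (∀ s ∈ ((alg n k M c α δ).run order₁ order₂ N).support,
          (s.2.passes : ℝ) ≤
            C * (k + (k : ℝ) ^ (C * k) / (α ^ 4 * M) * Real.log (2 / δ)) ∧
          s.2.peak ≤ M * wordSize n) ∧
        -- accuracy
        (0 < numGraphlets k G →
          ENNReal.ofReal (1 - δ) ≤
            ((alg n k M c α δ).run order₁ order₂ N).toOuterMeasure
              {s | ∀ i : GraphletClass k,
                |(alg n k M c α δ).output s.2.mem i - graphletDist G i| ≤ α}) := by
  have h_exists (n k M : ℕ) (c α δ : ℝ) (hn : 1 ≤ n) (hk : 3 ≤ k) (hc : 0 < c)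
      (hα : α ∈ Set.Ioo (0 : ℝ) 1) (hδ : δ ∈ Set.Ioo (0 : ℝ) 1)
      (hM : 256 * (n + k * Fintype.card (GraphletClass k)) ≤ M) :
      ∃ A : TwoPhaseAlg n k, Meets 256 M c α δ A := exists_meets hn hk hc hα hδ hM
  choose! alg h_meets using h_exists
  exact ⟨256, alg, h_meets⟩
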